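/- Let $\mathcal H_o=\mathbb C^n$ with $n\ge1$, attach a copy $\mathcal H_x$ of $\mathcal H_o$ to each site $x\in\mathbb Z^d$, and for finite $\Omega\subset\mathbb Z^d$ let $\mathcal A_\Omega$ be the algebra of all operators on $\mathcal H_\Omega=\bigotimes_{x\in\Omega}\mathcal H_x$. Let $\mathcal A=\overline{\bigcup_\Omega\mathcal A_\Omega}$ be the C*-algebra of quasi-local operators (closure in the operator norm), $\tau_x$ ($x\in\mathbb Z^d$) its translation automorphisms, and $\mathcal E$ the set of states of $\mathcal A$, i.e. of linear maps $\omega:\mathcal A\to\mathbb C$ with $\omega(1)=1$ and $\omega(A^*A)\ge0$ for all $A\in\mathcal A$. For finite $\Omega$ let $\mathcal A_{\Omega^c}=\overline{\bigcup_{\Omega'}\mathcal A_{\Omega'\setminus\Omega}}$, the union being over finite $\Omega'\subset\mathbb Z^d$. Let $\mathcal S_o\subset\mathbb Z^d$ be finite and let $h_o\in\mathcal A_{\mathcal S_o}$ be self-adjoint. Put $h_x=\tau_x(h_o)$, $\mathcal S_x=\mathcal S_o+x$, and, for finite $\Omega$, $H_\Omega=\sum_{x\in\Omega}h_x$ and $\overline\Omega=\{x:\mathcal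 S_x\cap\Omega\neq\emptyset\}$. For $L\ge1$ let $\Lambda_L=(\mathbb Z/L\mathbb Z)^d$, let $H^{\rm per}_{L}=\sum_{x\in\Lambda_L}h_x$ be the Hamiltonian on $\Lambda_L$ with periodic boundary conditions, and let $$e_L=\inf_{\rho}\ L^{-d}\rho(H^{\rm per}_{L}),\qquad \epsilon_0=\lim_{L\to\infty}e_L ,$$ where $\rho$ runs over all states of the algebra of operators on $\bigotimes_{x\in\Lambda_L}\mathcal H_x$. (Only large $L$ matter, for which the sites of $\mathcal S_o$ are distinct modulo $L$.) Define three sets of ground states: - $\mathcal G_1$ is the set of $\omega\in\mathcal E$ with $\omega(A^*[H_{\overline\Omega},A])\ge0$ for every finite $\Omega$ and every $A\in\mathcal A_\Omega$; - $\mathcal G_2$ is the set of $\omega\in\mathcal E$ with $\omega(H_{\overline\Omega})\le\omega(T(H_{\overline\Omega}))$ for every finite $\Omega$ and every local perturbation $T$ on $\Omega$, i.e. every linear map $T:\mathcal A\to\mathcal A$ with $T(A)\ge0$ whenever $A\ge0$ and $T(A)=A$ for all $A\in\mathcal A_{\Omega^c}$; - $\mathcal G_3$ is the set of $\omega\in\mathcal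 E$ with $\omega(h_x)=\epsilon_0$ for all $x\in\mathbb Z^d$. Let $\hat{\mathcal G}_i$ be the set of translation-invariant elements of $\mathcal G_i$, i.e. those $\omega\in\mathcal G_i$ with $\omega(\tau_x(A))=\omega(A)$ for all $A\in\mathcal A$ and $x\in\mathbb Z^d$. **Proposition.** The limit defining $\epsilon_0$ exists, and $\hat{\mathcal G}_1=\hat{\mathcal G}_2=\hat{\mathcal G}_3$. -/

import Mathlib

open scoped ComplexOrder

noncomputable section

namespace SpinLattice

/-! ### Coordinate pull-backs on `ℓ²` -/

/-- `ℓ²(X)`. -/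
abbrev L2 (X : Type) : Type := lp (fun _ : X => ℂ) 2

/-- The contraction `ℓ²(Y) → ℓ²(X)`, `ψ ↦ ψ ∘ e`, for an injective map `e : X → Y`. -/
def pull {X Y : Type} (e : X → Y) (he : Function.Injective e) : L2 Y →L[ℂ] L2 X :=
  LinearMap.mkContinuous
    { toFun := fun ψ => ⟨fun x => ψ (e x), by
        have h := (lp.memℓp ψ).summable (by norm_num)
        exact memℓp_gen (h.comp_injective he)⟩
      map_add' := fun ψ φ => by ext x; rfl
      map_smul' := fun c ψ => by ext x; rfl } 1 (fun ψ => by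
    rw [one_mul]
    have h := (lp.memℓp ψ).summable (by norm_num)
    refine lp.norm_le_of_tsum_le (by norm_num) (norm_nonneg _) ?_
    rw [lp.norm_rpow_eq_tsum (by norm_num)]
    exact (h.comp_injective he).tsum_le_tsum_of_inj e he (fun _ _ => by positivity)
      (fun _ => le_rfl) h)

@[simp] theorem pull_apply {X Y : Type} (e : X → Y) (he : Function.Injective e)
    (ψ : L2 Y) (x : X) : pull e he ψ x = ψ (e x) := rfl

theorem star_pull_apply {X Y : Type} [DecidableEq Y] [DecidableEq X] (e : X → Y)
    (he : Function.Injective e) (φ : L2 X) (y : Y) :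
    ContinuousLinearMap.adjoint (pull e he) φ y
      = inner ℂ (pull e he (lp.single 2 y (1 : ℂ))) φ := by
  rw [← ContinuousLinearMap.adjoint_inner_right, lp.inner_single_left]
  simp

theorem star_pull_apply_image {X Y : Type} (e : X → Y)
    (he : Function.Injective e) (φ : L2 X) (x : X) :
    ContinuousLinearMap.adjoint (pull e he) φ (e x) = φ x := by
  classical
  rw [star_pull_apply]
  have : pull e he (lp.single 2 (e x) (1 : ℂ)) = lp.single 2 x (1 : ℂ) := by
    ext z
    simp [Pi.single_apply, he.eq_iff]
  rw [this, lp.inner_single_left]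
  simp

theorem star_pull_apply_off {X Y : Type} (e : X → Y)
    (he : Function.Injective e) (φ : L2 X) (y : Y) (hy : ∀ x, e x ≠ y) :
    ContinuousLinearMap.adjoint (pull e he) φ y = 0 := by
  classical
  rw [star_pull_apply]
  have : pull e he (lp.single 2 y (1 : ℂ)) = 0 := by
    ext z
    simp [hy z]
  rw [this, inner_zero_left]

/-! ### Lattice, configurations, local operators -/

/-- The lattice `ℤ^d`. -/
abbrev Site (d : ℕ) : Type := Fin d → ℤ

/-- Basis labels of `⨂_{x ∈ Z} ℂⁿ`: the Hilbert space attached to a finite set `Z` of sites is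
`ℓ²(Conf n Z)`, and its operators are the matrices indexed by `Conf n Z`. -/
abbrev Conf (n : ℕ) (Z : Type) : Type := Z → Fin n

/-- All operators on the Hilbert space `⨂_{x ∈ Z} ℂⁿ`. -/
abbrev Op (n : ℕ) (Z : Type) [Fintype Z] [DecidableEq Z] : Type :=
  Matrix (Conf n Z) (Conf n Z) ℂ

/-- The operator `M ⊗ 1` on the sites `T`, where `M` acts on the sites `p s`, `s ∈ S`
(for injective `p : S → T`). -/
def extendOp {n : ℕ} {S T : Type} [Fintype S] [DecidableEq S] [Fintype T] [DecidableEq T]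
    (p : S → T) (M : Op n S) : Op n T :=
  Matrix.of fun σ τ => if ∀ y, (∀ s, p s ≠ y) → σ y = τ y then M (σ ∘ p) (τ ∘ p) else 0

/-- The ambient Hilbert space, with one basis vector for each configuration on all of `ℤ^d`.
Every local operator acts on it by changing finitely many coordinates. -/
abbrev Ambient (d n : ℕ) : Type := L2 (Conf n (Site d))

section LocalOperators

variable {d n : ℕ}

/-- The configuration equal to `s` on `Ω` and to `c` off `Ω`. -/
def glue (Ω : Finset (Site d)) (s : Conf n Ω) (c : Conf n {x // x ∉ Ω}) : Conf n (Site d) :=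
  fun x => if h : x ∈ Ω then s ⟨x, h⟩ else c ⟨x, h⟩

/-- Restriction of a configuration to `Ω`. -/
def res (Ω : Finset (Site d)) (σ : Conf n (Site d)) : Conf n Ω := fun x => σ x

/-- Restriction of a configuration to the complement of `Ω`. -/
def resCompl (Ω : Finset (Site d)) (σ : Conf n (Site d)) : Conf n {x // x ∉ Ω} := fun x => σ x

@[simp] theorem res_glue (Ω : Finset (Site d)) (s : Conf n Ω) (c : Conf n {x // x ∉ Ω}) :
    res Ω (glue Ω s c) = s := by
  funext x; simp [res, glue]

@[simp] theorem resCompl_glue (Ω : Finset (Site d)) (s : Conf n Ω)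
    (c : Conf n {x // x ∉ Ω}) : resCompl Ω (glue Ω s c) = c := by
  funext x; simp [resCompl, glue, x.2]

@[simp] theorem glue_res (Ω : Finset (Site d)) (σ : Conf n (Site d)) :
    glue Ω (res Ω σ) (resCompl Ω σ) = σ := by
  funext x; by_cases h : x ∈ Ω <;> simp [res, resCompl, glue, h]

theorem glue_injective (Ω : Finset (Site d)) (s : Conf n Ω) :
    Function.Injective (glue Ω s) := fun c c' h => by
  rw [← resCompl_glue Ω s c, h, resCompl_glue]

/-- `ψ ↦ ψ(s, ·)`, the component of `ψ` along the basis vector `s` of the sites in `Ω`. -/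
def slice (Ω : Finset (Site d)) (s : Conf n Ω) :
    Ambient d n →L[ℂ] L2 (Conf n {x // x ∉ Ω}) :=
  pull (glue Ω s) (glue_injective Ω s)

theorem slice_star_slice (Ω : Finset (Site d)) (s t : Conf n Ω) :
    (slice Ω s).comp (ContinuousLinearMap.adjoint (slice Ω t))
      = if s = t then ContinuousLinearMap.id ℂ _ else 0 := by
  ext φ c
  rw [ContinuousLinearMap.comp_apply, slice, pull_apply, slice]
  split_ifs with h
  · subst h
    rw [star_pull_apply_image]; rfl
  · rw [star_pull_apply_off]
    · rfl
    · intro c' hc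
      apply h
      rw [← res_glue Ω s c, ← hc, res_glue]

theorem star_slice_apply (Ω : Finset (Site d)) (s : Conf n Ω)
    (φ : L2 (Conf n {x // x ∉ Ω})) (σ : Conf n (Site d)) :
    ContinuousLinearMap.adjoint (slice Ω s) φ σ
      = if s = res Ω σ then φ (resCompl Ω σ) else 0 := by
  split_ifs with h
  · subst h
    conv_lhs => rw [← glue_res Ω σ]
    rw [res_glue, slice, star_pull_apply_image]
  · rw [slice, star_pull_apply_off]
    intro c hc
    exact h (by rw [← hc, res_glue])

/-- The bounded operator `M ⊗ 1` on the ambient space, `M` acting on the sites of `Ω`. -/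
def actFun (Ω : Finset (Site d)) (M : Op n Ω) : Ambient d n →L[ℂ] Ambient d n :=
  ∑ s, ∑ t, M s t • (ContinuousLinearMap.adjoint (slice Ω s)).comp (slice Ω t)

theorem actFun_apply (Ω : Finset (Site d)) (M : Op n Ω) (ψ : Ambient d n)
    (σ : Conf n (Site d)) :
    actFun Ω M ψ σ = ∑ t, M (res Ω σ) t * ψ (glue Ω t (resCompl Ω σ)) := by
  have key : ∀ s t, (M s t • (ContinuousLinearMap.adjoint (slice Ω s)).comp (slice Ω t)) ψ σ
      = if s = res Ω σ then M s t * ψ (glue Ω t (resCompl Ω σ)) else 0 := by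
    intro s t
    rw [smul_apply, lp.coeFn_smul, Pi.smul_apply,
      ContinuousLinearMap.comp_apply, star_slice_apply]
    split_ifs with h
    · rfl
    · simp
  simp only [actFun, sum_apply, lp.coeFn_sum, Finset.sum_apply, key]
  rw [Finset.sum_comm]
  simp

theorem op_ext {X : Type} {a b : L2 X →L[ℂ] L2 X} (h : ∀ ψ σ, a ψ σ = b ψ σ) : a = b := by
  ext ψ σ; exact h ψ σ

end LocalOperators

/-- The `*`-representation `M ↦ M ⊗ 1` of the operators on the sites of `Ω`. -/
def act {d n : ℕ} (Ω : Finset (Site d)) :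
    Op n Ω →⋆ₐ[ℂ] (Ambient d n →L[ℂ] Ambient d n) where
  toFun := actFun Ω
  map_one' := by
    refine op_ext fun ψ σ => ?_
    rw [actFun_apply]
    simp [Matrix.one_apply]
  map_mul' M N := by
    refine op_ext fun ψ σ => ?_
    rw [mul_apply_eq_comp, actFun_apply, actFun_apply]
    simp only [actFun_apply, res_glue, resCompl_glue, Matrix.mul_apply, Finset.sum_mul,
      Finset.mul_sum, mul_assoc]
    exact Finset.sum_comm
  map_zero' := by simp [actFun]
  map_add' M N := by simp [actFun, add_smul, Finset.sum_add_distrib]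
  commutes' r := by
    refine op_ext fun ψ σ => ?_
    rw [actFun_apply]
    simp [Matrix.algebraMap_matrix_apply, Algebra.algebraMap_eq_smul_one]
  map_star' M := by
    simp only [actFun, ContinuousLinearMap.star_eq_adjoint, map_sum, map_smulₛₗ,
      ContinuousLinearMap.adjoint_comp, ContinuousLinearMap.adjoint_adjoint]
    rw [Finset.sum_comm]
    rfl

theorem act_apply {d n : ℕ} (Ω : Finset (Site d)) (M : Op n Ω) (ψ : Ambient d n)
    (σ : Conf n (Site d)) :
    act Ω M ψ σ = ∑ t, M (res Ω σ) t * ψ (glue Ω t (resCompl Ω σ)) := actFun_apply Ω M ψ σ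

/-- For `n ≥ 1` the representation is faithful, hence isometric: the ambient operator norm of a
local operator is its operator norm on the finite-dimensional Hilbert space of `Ω`. -/
theorem act_injective {d n : ℕ} [NeZero n] (Ω : Finset (Site d)) :
    Function.Injective (act (n := n) Ω) := by
  classical
  intro M N h
  ext s t
  let c : Conf n {x // x ∉ Ω} := fun _ => 0
  have key : ∀ K : Op n Ω,
      act Ω K (lp.single 2 (glue Ω t c) (1 : ℂ)) (glue Ω s c) = K s t := by
    intro K
    rw [act_apply, Finset.sum_eq_single t]
    · simp
    · intro u _ hu
      have : glue Ω u c ≠ glue Ω t c := fun hh => hu (by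
        rw [← res_glue Ω u c, hh, res_glue])
      simp [this]
    · simp
  rw [← key M, ← key N, h]

theorem act_extendOp {d n : ℕ} {Ω Ω' : Finset (Site d)} (h : Ω ⊆ Ω') (M : Op n Ω) :
    act Ω' (extendOp (fun x : Ω => (⟨x, h x.2⟩ : Ω')) M) = act Ω M := by
  refine op_ext fun ψ σ => ?_
  rw [act_apply, act_apply]
  symm
  refine Finset.sum_of_injOn
    (fun t => res Ω' (glue Ω t (resCompl Ω σ))) ?_ (by simp) ?_ ?_
  · intro t _ t' _ htt
    funext x
    have := congrFun htt ⟨x, h x.2⟩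
    simpa [res, glue] using this
  · intro t' _ ht'
    have hne : ¬ ∀ y : Ω', (∀ s : Ω, (⟨s, h s.2⟩ : Ω') ≠ y) → res Ω' σ y = t' y := by
      intro hy
      apply ht'
      refine ⟨fun x => t' ⟨x, h x.2⟩, by simp, ?_⟩
      funext y
      by_cases hyΩ : (y : Site d) ∈ Ω
      · simp [res, glue, hyΩ]
      · have := hy y (fun s hs => hyΩ (by rw [← hs]; exact s.2))
        simpa [res, glue, hyΩ, resCompl] using this
    simp only [extendOp, Matrix.of_apply]
    rw [if_neg hne, zero_mul]
  · intro t _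
    have h1 : ∀ y : Ω', (∀ s : Ω, (⟨s, h s.2⟩ : Ω') ≠ y) →
        res Ω' σ y = res Ω' (glue Ω t (resCompl Ω σ)) y := by
      intro y hy
      have hyΩ : (y : Site d) ∉ Ω := fun hh => hy ⟨y, hh⟩ rfl
      simp [res, glue, hyΩ, resCompl]
    simp only [extendOp, Matrix.of_apply]
    rw [if_pos h1]
    congr 1
    · congr 1
      funext x
      simp [res, glue]
    · refine congrArg ψ ?_
      funext x
      by_cases hx : x ∈ Ω
      · simp [glue, hx, h hx, res]
      · by_cases hx' : x ∈ Ω' <;> simp [glue, hx, hx', res, resCompl]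

theorem range_act_mono {d n : ℕ} :
    Monotone fun Ω : Finset (Site d) => (act (n := n) Ω).range := by
  rintro Ω Ω' h _ ⟨M, rfl⟩
  exact ⟨_, act_extendOp h M⟩

/-! ### Translations -/

/-- Shift of configurations. -/
def shift {d n : ℕ} (x : Site d) (σ : Conf n (Site d)) : Conf n (Site d) := fun y => σ (y + x)

theorem shift_shift {d n : ℕ} (x y : Site d) (σ : Conf n (Site d)) :
    shift x (shift y σ) = shift (x + y) σ := by
  funext z; simp [shift, add_assoc]

theorem shift_zero {d n : ℕ} (σ : Conf n (Site d)) : shift 0 σ = σ := by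
  funext z; simp [shift]

theorem shift_injective {d n : ℕ} (x : Site d) :
    Function.Injective (shift (n := n) x) := fun σ τ h => by
  rw [← shift_zero σ, ← neg_add_cancel x, ← shift_shift, h, shift_shift, neg_add_cancel,
    shift_zero]

/-- The unitary implementing the lattice translation by `x`. -/
def shiftOp {d n : ℕ} (x : Site d) : Ambient d n →L[ℂ] Ambient d n :=
  pull (shift x) (shift_injective x)

theorem star_shiftOp {d n : ℕ} (x : Site d) :
    star (shiftOp (n := n) x) = shiftOp (-x) := by
  refine op_ext fun ψ σ => ?_
  have h : shift x (shift (-x) σ) = σ := by rw [shift_shift, add_neg_cancel, shift_zero]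
  conv_lhs => rw [← h]
  rw [ContinuousLinearMap.star_eq_adjoint, shiftOp, star_pull_apply_image]
  rfl

theorem star_shiftOp_mul {d n : ℕ} (x : Site d) :
    star (shiftOp (n := n) x) * shiftOp x = 1 := by
  rw [star_shiftOp]
  refine op_ext fun ψ σ => ?_
  change ψ (shift x (shift (-x) σ)) = ψ σ
  rw [shift_shift, add_neg_cancel, shift_zero]

theorem shiftOp_mul_star {d n : ℕ} (x : Site d) :
    shiftOp (n := n) x * star (shiftOp x) = 1 := by
  rw [star_shiftOp]
  refine op_ext fun ψ σ => ?_
  change ψ (shift (-x) (shift x σ)) = ψ σ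
  rw [shift_shift, neg_add_cancel, shift_zero]

/-- Conjugation by the translation unitary. -/
def conjShift {d n : ℕ} (x : Site d) :
    (Ambient d n →L[ℂ] Ambient d n) →⋆ₐ[ℂ] (Ambient d n →L[ℂ] Ambient d n) where
  toFun a := shiftOp x * a * star (shiftOp x)
  map_one' := by rw [mul_one, shiftOp_mul_star]
  map_mul' a b := by
    calc shiftOp x * (a * b) * star (shiftOp x)
        = shiftOp x * a * 1 * b * star (shiftOp x) := by simp only [mul_one, mul_assoc]
      _ = _ := by rw [← star_shiftOp_mul x]; simp only [mul_assoc]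
  map_zero' := by simp
  map_add' a b := by rw [mul_add, add_mul]
  commutes' r := by
    rw [Algebra.algebraMap_eq_smul_one, mul_smul_comm, mul_one, smul_mul_assoc,
      shiftOp_mul_star]
  map_star' a := by simp only [star_mul, star_star, mul_assoc]

/-- The translate `Ω + x`. -/
def translate {d : ℕ} (x : Site d) (Ω : Finset (Site d)) : Finset (Site d) :=
  Ω.map (addRightEmbedding x)

/-- Sites of `Ω + x` correspond to sites of `Ω`. -/
def translateEquiv {d : ℕ} (x : Site d) (Ω : Finset (Site d)) : Ω ≃ translate x Ω where
  toFun y := ⟨y + x, by simp [translate]⟩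
  invFun y := ⟨y - x, by
    obtain ⟨y, hy⟩ := y
    simp only [translate, Finset.mem_map, addRightEmbedding_apply] at hy
    obtain ⟨z, hz, rfl⟩ := hy
    simpa using hz⟩
  left_inv y := by simp
  right_inv y := by simp

theorem conjShift_act {d n : ℕ} (x : Site d) (Ω : Finset (Site d)) (M : Op n Ω) :
    conjShift x (act Ω M)
      = act (translate x Ω) (extendOp (translateEquiv x Ω) M) := by
  have hmem : ∀ y, y ∈ translate x Ω ↔ y - x ∈ Ω := by
    intro y
    simp only [translate, Finset.mem_map, addRightEmbedding_apply]
    exact ⟨by rintro ⟨z, hz, rfl⟩; simpa using hz, fun h => ⟨y - x, h, by simp⟩⟩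
  refine op_ext fun ψ σ => ?_
  have h1 : conjShift x (act Ω M) ψ σ
      = act Ω M (shiftOp (-x) ψ) (shift x σ) := by
    change ((shiftOp x * act Ω M * star (shiftOp x) : Ambient d n →L[ℂ] Ambient d n) ψ) σ = _
    rw [star_shiftOp]
    rfl
  rw [h1, act_apply, act_apply]
  refine Fintype.sum_equiv ((translateEquiv x Ω).arrowCongr (Equiv.refl _)) _ _ fun t => ?_
  have h2 : ∀ y, (∀ s, translateEquiv x Ω s ≠ y) → res (translate x Ω) σ y
      = (translateEquiv x Ω).arrowCongr (Equiv.refl _) t y :=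
    fun y hy => absurd ((translateEquiv x Ω).apply_symm_apply y) (hy _)
  simp only [extendOp, Matrix.of_apply]
  rw [if_pos h2]
  congr 1
  · congr 1
    funext s
    simp [Equiv.arrowCongr]
  · refine congrArg ψ ?_
    funext y
    have hy := hmem y
    by_cases hyx : y - x ∈ Ω
    · simp [shift, glue, ← sub_eq_add_neg, hyx, hy, Equiv.arrowCongr, translateEquiv]
    · simp [shift, glue, ← sub_eq_add_neg, hyx, hy, resCompl]

/-! ### The quasi-local algebra -/

/-- The algebra of local operators: the union over all finite `Ω` of the operators on `Ω`. -/
def localAlgebra (d n : ℕ) : StarSubalgebra ℂ (Ambient d n →L[ℂ] Ambient d n) :=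
  ⨆ Ω : Finset (Site d), (act (n := n) Ω).range

theorem mem_localAlgebra {d n : ℕ} {a : Ambient d n →L[ℂ] Ambient d n} :
    a ∈ localAlgebra d n ↔ ∃ (Ω : Finset (Site d)) (M : Op n Ω), act Ω M = a := by
  rw [← SetLike.mem_coe, localAlgebra,
    StarSubalgebra.coe_iSup_of_directed range_act_mono.directed_le, Set.mem_iUnion]
  rfl

/-- The norm closure of the local operators. -/
def quasiLocal (d n : ℕ) : StarSubalgebra ℂ (Ambient d n →L[ℂ] Ambient d n) :=
  (localAlgebra d n).topologicalClosure

/-- The C*-algebra `𝒜` of quasi-local operators on `ℤ^d` with single-site space `ℂⁿ`. -/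
abbrev QL (d n : ℕ) : Type := quasiLocal d n

/-- The inclusion of the operators on `Ω` into `𝒜`. -/
def emb {d n : ℕ} (Ω : Finset (Site d)) : Op n Ω →⋆ₐ[ℂ] QL d n :=
  StarAlgHom.codRestrict (act Ω) (quasiLocal d n) fun M =>
    (localAlgebra d n).le_topologicalClosure (mem_localAlgebra.2 ⟨Ω, M, rfl⟩)

theorem conjShift_mem {d n : ℕ} (x : Site d) (a : QL d n) :
    conjShift x (a : Ambient d n →L[ℂ] Ambient d n) ∈ quasiLocal d n := by
  have hc : Continuous (conjShift (n := n) x) :=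
    (continuous_const.mul continuous_id).mul continuous_const
  refine map_mem_closure hc a.2 ?_
  intro b hb
  obtain ⟨Ω, M, rfl⟩ := mem_localAlgebra.1 hb
  rw [conjShift_act]
  exact mem_localAlgebra.2 ⟨_, _, rfl⟩

/-- The translation automorphism `τ_x` of `𝒜`. -/
def tau {d n : ℕ} (x : Site d) : QL d n →⋆ₐ[ℂ] QL d n :=
  StarAlgHom.codRestrict ((conjShift x).comp (quasiLocal d n).subtype) (quasiLocal d n)
    (conjShift_mem x)

/-- `τ_x` moves an operator on `Ω` to the same operator on `Ω + x`. -/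
theorem tau_emb {d n : ℕ} (x : Site d) (Ω : Finset (Site d)) (M : Op n Ω) :
    tau x (emb Ω M) = emb (translate x Ω) (extendOp (translateEquiv x Ω) M) :=
  Subtype.ext (conjShift_act x Ω M)

/-- The set `𝒜_Ω ⊆ 𝒜` of operators on `Ω`. -/
def localOps {d : ℕ} (n : ℕ) (Ω : Finset (Site d)) : Set (QL d n) := Set.range (emb Ω)

/-- The algebra `𝒜_{Ωᶜ}` of quasi-local operators outside `Ω`. -/
def outsideOps {d : ℕ} (n : ℕ) (Ω : Finset (Site d)) : Set (QL d n) :=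
  closure (⋃ Ω' : Finset (Site d), localOps n (Ω' \ Ω))

/-! ### States -/

/-- A state on a unital `*`-algebra: a normalized positive linear functional. In `ℂ`, the
inequality `0 ≤ z` says that `z` is real and nonnegative. -/
structure IsState {A : Type} [Ring A] [StarRing A] [Algebra ℂ A] (ω : A →ₗ[ℂ] ℂ) : Prop where
  map_one : ω 1 = 1
  nonneg : ∀ a, 0 ≤ ω (star a * a)

/-- Positive elements of a C*-algebra. -/
def IsPos {A : Type} [Ring A] [StarRing A] (a : A) : Prop := ∃ b, a = star b * b

/-- Translation invariance of a functional on `𝒜`. -/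
def IsTranslationInvariant {d n : ℕ} (ω : QL d n →ₗ[ℂ] ℂ) : Prop :=
  ∀ (x : Site d) (a : QL d n), ω (tau x a) = ω a

/-! ### The Hamiltonian, and the three notions of ground state -/

section Hamiltonian

variable {d n : ℕ} (S : Finset (Site d)) (h : Op n S)

/-- The local Hamiltonian `h_x = τ_x(h_o)`, where `h_o` is the operator `h` on the sites `S`. -/
def localHam (x : Site d) : QL d n := tau x (emb S h)

/-- `H_Ω = ∑_{x ∈ Ω} h_x`. -/
def ham (Ω : Finset (Site d)) : QL d n := ∑ x ∈ Ω, localHam S h x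

/-- The set of all `x` for which the support `S + x` of `h_x` meets `Ω`. -/
def enlarge (Ω : Finset (Site d)) : Finset (Site d) :=
  (Ω ×ˢ S).image fun p => p.1 - p.2

theorem mem_enlarge {Ω : Finset (Site d)} {x : Site d} :
    x ∈ enlarge S Ω ↔ (translate x S ∩ Ω).Nonempty := by
  simp only [enlarge, translate, Finset.mem_image, Finset.mem_product, Finset.Nonempty,
    Finset.mem_inter, Finset.mem_map, addRightEmbedding_apply, Prod.exists]
  constructor
  · rintro ⟨y, s, ⟨hy, hs⟩, rfl⟩
    exact ⟨y, ⟨s, hs, by abel⟩, hy⟩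
  · rintro ⟨y, ⟨s, hs, rfl⟩, hy⟩
    exact ⟨s + x, s, ⟨hy, hs⟩, by abel⟩

/-- First definition: `ω(A* [H_Ω̄, A]) ≥ 0` for all finite `Ω` and all `A ∈ 𝒜_Ω`. -/
def GroundStates₁ : Set (QL d n →ₗ[ℂ] ℂ) :=
  {ω | IsState ω ∧ ∀ Ω : Finset (Site d), ∀ A ∈ localOps n Ω,
    0 ≤ ω (star A * (ham S h (enlarge S Ω) * A - A * ham S h (enlarge S Ω)))}

/-- A local perturbation on `Ω`: a positive linear map `𝒜 → 𝒜` that fixes every operator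
outside `Ω`. -/
structure IsLocalPerturbation (Ω : Finset (Site d)) (T : QL d n →ₗ[ℂ] QL d n) : Prop where
  pos : ∀ a, IsPos a → IsPos (T a)
  fix : ∀ a ∈ outsideOps n Ω, T a = a

/-- Second definition: local perturbations on `Ω` do not lower the energy `H_Ω̄`. -/
def GroundStates₂ : Set (QL d n →ₗ[ℂ] ℂ) :=
  {ω | IsState ω ∧ ∀ Ω : Finset (Site d), ∀ T, IsLocalPerturbation Ω T →
    ω (ham S h (enlarge S Ω)) ≤ ω (T (ham S h (enlarge S Ω)))}

/-- The periodic lattice with `L` sites in each direction. -/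
abbrev Torus (d L : ℕ) : Type := Fin d → ZMod L

/-- The operator `h_x` on the periodic lattice: `h` acts on the sites `x + s`, `s ∈ S`. -/
def torusLocalHam (L : ℕ) [NeZero L] (x : Torus d L) : Op n (Torus d L) :=
  extendOp (fun s : S => fun i => x i + ((s : Site d) i : ZMod L)) h

/-- The Hamiltonian `∑_x h_x` with periodic boundary conditions. -/
def torusHam (L : ℕ) [NeZero L] : Op n (Torus d L) := ∑ x, torusLocalHam S h L x

/-- The ground state energy per site on the periodic lattice, as an infimum over all states. -/
def torusEnergy (L : ℕ) [NeZero L] : ℝ :=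
  sInf {e : ℝ | ∃ ρ : Op n (Torus d L) →ₗ[ℂ] ℂ, IsState ρ ∧
    e = (ρ (torusHam S h L)).re / (L : ℝ) ^ d}

/-- The ground state energy density `ε₀ = lim_{L → ∞}` of the energy per site. -/
def energyDensity : ℝ :=
  Filter.limUnder Filter.atTop fun L : ℕ => torusEnergy S h (L + 1)

/-- Third definition: `ω(h_x) = ε₀` for all sites `x`. -/
def GroundStates₃ : Set (QL d n →ₗ[ℂ] ℂ) :=
  {ω | IsState ω ∧ ∀ x : Site d, ω (localHam S h x) = (energyDensity S h : ℂ)}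

end Hamiltonian

/-- The translation invariant members of a set of functionals. -/
def invariantPart {d n : ℕ} (G : Set (QL d n →ₗ[ℂ] ℂ)) : Set (QL d n →ₗ[ℂ] ℂ) :=
  {ω | ω ∈ G ∧ IsTranslationInvariant ω}

end SpinLattice

end

/-!
# Three notions of translation invariant ground state coincide

The argument compares three energies per site of a box of side `L`: the periodic ground state
energy, the minimum `minEnergy` of the energy `H_Λ` of the box over all states of the infinite
system, and the energy of a given invariant state.

The minimal energy is superadditive along tilings of a large box by smaller ones, hence converges
per site (`exists_tendsto_minEnergy`). It differs from the periodic ground state energy by a surface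
term (`abs_torusEnergy_sub_minEnergy_le`): a state of the infinite system restricts to a state of
the periodic lattice, and conversely, if `v` is a periodic ground state vector, the perturbation
`a ↦ ∑ₜ |t⟩⟨v| a |v⟩⟨t|` on the box replaces any state by one that looks like `v` in the box. So
the periodic energies per site have a limit `ε₀`, which is the limit of the minimal energies.

Local perturbations `a ↦ ∑ⱼ Kⱼ* a Kⱼ` with `∑ⱼ Kⱼ* Kⱼ = 1` do not lower the energy of a ground state
in the first sense, by summing the commutator inequalities for the `Kⱼ`, and in the second sense, by
definition (`IsKrausStable`). Applied to the perturbation above, this shows that an invariant ground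
state of either kind has energy `ε₀` per site (`IsKrausStable.energy_eq`), which is the third
notion.

Conversely, let `ω` be invariant with energy `ε₀` per site. If a local perturbation lowered its
energy, then translates of it, placed on a sparse sublattice and applied one after the other, would
each lower the energy by a fixed amount (`exists_isState_lower`). The energy change need not be
local, but it is so up to a small error, which is why sparse translates do not interfere. Thus the
energy per site could be lowered below `ε₀`, which is impossible
(`mem_groundStates₂_of_energy_eq`).

Finally, a state of the second kind is of the first kind: for `a` on `Ω` apply stability to the two
Kraus operators `(1 - t a*a) r` and `2 √t a r` with `r = (1 + t a*a)⁻¹`, and differentiate at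
`t = 0` (`IsKrausStable.mem_groundStates₁`).
-/

namespace SpinLattice

/-! ### Matrices -/

open Matrix in
/-- The bottom `l` of the spectrum of a Hermitian matrix is an attained expectation value, and
`l ≤ M`. -/
theorem exists_min_eigenvector {m : Type} [Fintype m] [DecidableEq m] [Nonempty m]
    {M : Matrix m m ℂ} (hM : M.IsHermitian) :
    ∃ (l : ℝ) (v : m → ℂ), star v ⬝ᵥ v = 1 ∧ star v ⬝ᵥ (M *ᵥ v) = l ∧
      (M - (l : ℂ) • 1).PosSemidef := by
  obtain ⟨i, -, hi⟩ := Finset.exists_min_image Finset.univ hM.eigenvalues Finset.univ_nonempty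
  have hnorm : star (hM.eigenvectorBasis i : m → ℂ) ⬝ᵥ (hM.eigenvectorBasis i : m → ℂ) = 1 := by
    have h1 := hM.eigenvectorBasis.orthonormal.1 i
    have h2 : inner ℂ (hM.eigenvectorBasis i) (hM.eigenvectorBasis i) = (1 : ℂ) := by
      rw [inner_self_eq_norm_sq_to_K, h1]; simp
    rw [EuclideanSpace.inner_eq_star_dotProduct] at h2
    rw [dotProduct_comm]; exact h2
  refine ⟨hM.eigenvalues i, hM.eigenvectorBasis i, hnorm, ?_, ?_⟩
  · rw [hM.mulVec_eigenvectorBasis, dotProduct_smul, hnorm]; simp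
  · let U : Matrix m m ℂ := hM.eigenvectorUnitary
    have hU : U * Uᴴ = 1 := Unitary.mul_star_self_of_mem hM.eigenvectorUnitary.2
    have hs : M = U * diagonal (RCLike.ofReal ∘ hM.eigenvalues) * Uᴴ := hM.spectral_theorem
    have hD : M - (hM.eigenvalues i : ℂ) • 1
        = U * diagonal (fun j => ((hM.eigenvalues j - hM.eigenvalues i : ℝ) : ℂ)) * Uᴴ := by
      have : diagonal (fun j => ((hM.eigenvalues j - hM.eigenvalues i : ℝ) : ℂ))
          = diagonal (RCLike.ofReal ∘ hM.eigenvalues) - (hM.eigenvalues i : ℂ) • 1 := by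
        rw [smul_one_eq_diagonal, diagonal_sub]
        simp
      rw [this, mul_sub, sub_mul, ← hs, mul_smul_comm, smul_mul_assoc, mul_one, hU]
    rw [hD]
    refine PosSemidef.mul_mul_conjTranspose_same (PosSemidef.diagonal fun j => ?_) U
    simpa [Complex.zero_le_real, -Complex.ofReal_sub] using hi j (Finset.mem_univ _)

/-! ### Extension of operators to larger sets of sites -/

section ExtendOp

variable {n : ℕ} {S T U : Type} [Fintype S] [DecidableEq S] [Fintype T] [DecidableEq T]
  [Fintype U] [DecidableEq U]

theorem extendOp_comp (p : S → T) {q : T → U} (hq : Function.Injective q) (M : Op n S) :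
    extendOp q (extendOp p M) = extendOp (q ∘ p) M := by
  ext σ τ
  simp only [extendOp, Matrix.of_apply, Function.comp_assoc]
  rw [← ite_and]
  refine if_congr ⟨?_, ?_⟩ rfl rfl
  · rintro ⟨h1, h2⟩ y hy
    by_cases h : ∃ t, q t = y
    · obtain ⟨t, rfl⟩ := h
      exact h2 t fun s hs => hy s (by simp [hs])
    · exact h1 y fun t ht => h ⟨t, ht⟩
  · refine fun h => ⟨fun y hy => h y fun s => hy (p s), fun t ht => h (q t) fun s hs => ht s ?_⟩
    exact hq hs

theorem extendOp_star (p : S → T) (M : Op n S) :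
    extendOp p (star M) = star (extendOp p M) := by
  ext σ τ
  simp only [extendOp, Matrix.of_apply, Matrix.star_apply]
  rw [apply_ite star, star_zero]
  exact if_congr ⟨fun h y hy => (h y hy).symm, fun h y hy => (h y hy).symm⟩ rfl rfl

theorem extendOp_one {p : S → T} : extendOp p (1 : Op n S) = 1 := by
  ext σ τ
  simp only [extendOp, Matrix.of_apply, Matrix.one_apply]
  rw [← ite_and]
  refine if_congr ⟨?_, ?_⟩ rfl rfl
  · rintro ⟨h1, h2⟩
    funext y
    by_cases h : ∃ s, p s = y
    · obtain ⟨s, rfl⟩ := h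
      exact congrFun h2 s
    · exact h1 y fun t ht => h ⟨t, ht⟩
  · rintro rfl
    exact ⟨fun _ _ => rfl, rfl⟩

theorem extendOp_mul {p : S → T} (hp : Function.Injective p) (M N : Op n S) :
    extendOp p (M * N) = extendOp p M * extendOp p N := by
  classical
  ext σ τ
  -- `g s` agrees with `s` on the sites of `p` and with `σ` elsewhere; only such intermediate
  -- configurations contribute to the matrix product
  let g : Conf n S → Conf n T := fun s y => if h : ∃ x, p x = y then s h.choose else σ y
  have hg1 : ∀ s, g s ∘ p = s := by
    intro s; funext x
    have h : ∃ x', p x' = p x := ⟨x, rfl⟩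
    simp only [g, Function.comp_apply, dif_pos h]
    rw [hp h.choose_spec]
  have hg2 : ∀ s y, (∀ x, p x ≠ y) → g s y = σ y := by
    intro s y hy
    have h : ¬ ∃ x', p x' = y := fun ⟨x, hx⟩ => hy x hx
    simp only [g, dif_neg h]
  have hR : (extendOp p M * extendOp p N) σ τ
      = ∑ s, extendOp p M σ (g s) * extendOp p N (g s) τ := by
    rw [Matrix.mul_apply]
    symm
    refine Finset.sum_of_injOn g (fun s _ s' _ hs => ?_) (by simp) ?_ (fun _ _ => rfl)
    · rw [← hg1 s, hs, hg1]
    · intro ρ _ hρ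
      have : ¬ ∀ y, (∀ s, p s ≠ y) → σ y = ρ y := by
        intro h
        refine hρ ⟨ρ ∘ p, by simp, ?_⟩
        funext y
        by_cases hy : ∃ x, p x = y
        · obtain ⟨x, rfl⟩ := hy
          exact congrFun (hg1 (ρ ∘ p)) x
        · have hy' : ∀ x, p x ≠ y := fun x hx => hy ⟨x, hx⟩
          rw [hg2 _ _ hy', h y hy']
      simp only [extendOp, Matrix.of_apply]
      rw [if_neg this, zero_mul]
  rw [hR]
  simp only [extendOp, Matrix.of_apply, hg1, Matrix.mul_apply]
  split_ifs with h
  · refine Finset.sum_congr rfl fun s _ => ?_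
    rw [if_pos fun y hy => (hg2 s y hy).symm, if_pos fun y hy => (hg2 s y hy).trans (h y hy)]
  · refine (Finset.sum_eq_zero fun s _ => ?_).symm
    rw [if_neg (fun h' => h fun y hy => (hg2 s y hy).symm.trans (h' y hy) :
      ¬ ∀ y, (∀ s, p s ≠ y) → g s y = τ y), mul_zero]

end ExtendOp

/-! ### Local operators and translations -/

section Local

variable {d n : ℕ}

theorem act_commute_of_disjoint {Ω Z : Finset (Site d)} (hd : Disjoint Ω Z)
    (M : Op n Ω) (N : Op n Z) : act Ω M * act Z N = act Z N * act Ω M := by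
  have hΩ : ∀ x ∈ Ω, x ∉ Z := fun x hx hz => Finset.disjoint_left.1 hd hx hz
  have hZ : ∀ x ∈ Z, x ∉ Ω := fun x hz hx => Finset.disjoint_left.1 hd hx hz
  refine op_ext fun ψ σ => ?_
  rw [mul_apply_eq_comp, mul_apply_eq_comp, act_apply, act_apply]
  simp only [act_apply, Finset.mul_sum]
  rw [Finset.sum_comm]
  refine Finset.sum_congr rfl fun t _ => Finset.sum_congr rfl fun s _ => ?_
  have h1 : res Z (glue Ω s (resCompl Ω σ)) = res Z σ := by
    funext x; simp [res, glue, hZ x x.2, resCompl]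
  have h2 : res Ω (glue Z t (resCompl Z σ)) = res Ω σ := by
    funext x; simp [res, glue, hΩ x x.2, resCompl]
  have h3 : glue Z t (resCompl Z (glue Ω s (resCompl Ω σ)))
      = glue Ω s (resCompl Ω (glue Z t (resCompl Z σ))) := by
    funext x
    by_cases hx : x ∈ Ω
    · simp [glue, hx, hΩ x hx, resCompl]
    · by_cases hx' : x ∈ Z <;> simp [glue, hx, hx', resCompl]
  rw [h1, h2, h3]
  ring

theorem emb_commute_of_disjoint {Ω Z : Finset (Site d)} (hd : Disjoint Ω Z)
    (M : Op n Ω) (N : Op n Z) : emb Ω M * emb Z N = emb Z N * emb Ω M :=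
  Subtype.ext (act_commute_of_disjoint hd M N)

theorem emb_extendOp {Ω Ω' : Finset (Site d)} (h : Ω ⊆ Ω') (M : Op n Ω) :
    emb Ω' (extendOp (fun x : Ω => (⟨x, h x.2⟩ : Ω')) M) = emb Ω M :=
  Subtype.ext (act_extendOp h M)

theorem localOps_mono {Ω Ω' : Finset (Site d)} (h : Ω ⊆ Ω') : localOps n Ω ⊆ localOps n Ω' := by
  rintro _ ⟨M, rfl⟩
  exact ⟨_, emb_extendOp h M⟩

theorem localOps_subset_outsideOps {Ω Z : Finset (Site d)} (h : Disjoint Ω Z) :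
    localOps n Z ⊆ outsideOps n Ω := by
  intro a ha
  refine subset_closure (Set.mem_iUnion.2 ⟨Z, ?_⟩)
  rwa [Finset.sdiff_eq_self_of_disjoint h.symm]

theorem one_mem_localOps (Ω : Finset (Site d)) : (1 : QL d n) ∈ localOps n Ω := ⟨1, map_one _⟩

theorem conjShift_conjShift (x y : Site d) (a : Ambient d n →L[ℂ] Ambient d n) :
    conjShift x (conjShift y a) = conjShift (x + y) a := by
  have h : shiftOp (n := n) x * shiftOp y = shiftOp (x + y) := by
    refine op_ext fun ψ σ => ?_
    change ψ (shift y (shift x σ)) = ψ (shift (x + y) σ)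
    rw [shift_shift, add_comm]
  change shiftOp x * (shiftOp y * a * star (shiftOp y)) * star (shiftOp x)
    = shiftOp (x + y) * a * star (shiftOp (x + y))
  rw [← h, star_mul]
  simp only [mul_assoc]

theorem tau_tau (x y : Site d) (a : QL d n) : tau x (tau y a) = tau (x + y) a :=
  Subtype.ext (conjShift_conjShift x y _)

theorem tau_zero (a : QL d n) : tau 0 a = a := by
  refine Subtype.ext (op_ext fun ψ σ => ?_)
  change (shiftOp 0 * (a : Ambient d n →L[ℂ] Ambient d n) * star (shiftOp 0) :
    Ambient d n →L[ℂ] Ambient d n) ψ σ = _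
  have h : shiftOp (d := d) (n := n) 0 = 1 := by
    refine op_ext fun ψ σ => ?_
    change ψ (shift 0 σ) = ψ σ
    rw [shift_zero]
  rw [h, star_one, one_mul, mul_one]

theorem mem_translate {x y : Site d} {Ω : Finset (Site d)} :
    y ∈ translate x Ω ↔ y - x ∈ Ω := by
  simp only [translate, Finset.mem_map, addRightEmbedding_apply]
  exact ⟨by rintro ⟨z, hz, rfl⟩; simpa using hz, fun h => ⟨y - x, h, by simp⟩⟩

theorem tau_mem_localOps {x : Site d} {Ω : Finset (Site d)} {a : QL d n} (ha : a ∈ localOps n Ω) :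
    tau x a ∈ localOps n (translate x Ω) := by
  obtain ⟨M, rfl⟩ := ha
  exact ⟨_, (tau_emb x Ω M).symm⟩

end Local

/-! ### States -/

section States

variable {A B : Type} [Ring A] [StarRing A] [Algebra ℂ A] [Ring B] [StarRing B] [Algebra ℂ B]

theorem IsState.comp {ω : B →ₗ[ℂ] ℂ} (hω : IsState ω) {T : A →ₗ[ℂ] B} (h1 : T 1 = 1)
    (hT : ∀ a, IsPos a → IsPos (T a)) : IsState (ω ∘ₗ T) where
  map_one := by simp [h1, hω.map_one]
  nonneg a := by
    obtain ⟨b, hb⟩ := hT _ ⟨a, rfl⟩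
    rw [LinearMap.comp_apply, hb]
    exact hω.nonneg b

theorem IsPos.map (φ : A →⋆ₐ[ℂ] B) {a : A} (ha : IsPos a) : IsPos (φ a) := by
  obtain ⟨b, rfl⟩ := ha
  exact ⟨φ b, by rw [map_mul, map_star]⟩

theorem IsState.comp_starAlgHom {ω : B →ₗ[ℂ] ℂ} (hω : IsState ω) (φ : A →⋆ₐ[ℂ] B) :
    IsState (ω ∘ₗ φ.toAlgHom.toLinearMap) :=
  hω.comp (T := φ.toAlgHom.toLinearMap) (_root_.map_one φ) fun _ ha => ha.map φ

/-- `c + a` and `c - a` are both positive; in a C*-algebra this says that `a` is self-adjoint of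
norm at most `c`. -/
def IsBoundedBy (c : ℝ) (a : A) : Prop := IsPos ((c : ℂ) • 1 + a) ∧ IsPos ((c : ℂ) • 1 - a)

theorem IsBoundedBy.map {c : ℝ} {a : A} (ha : IsBoundedBy c a) {T : A →ₗ[ℂ] B} (h1 : T 1 = 1)
    (hT : ∀ a, IsPos a → IsPos (T a)) : IsBoundedBy c (T a) := by
  constructor
  · simpa [h1] using hT _ ha.1
  · simpa [h1] using hT _ ha.2

theorem IsBoundedBy.map_starAlgHom {c : ℝ} {a : A} (ha : IsBoundedBy c a) (φ : A →⋆ₐ[ℂ] B) :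
    IsBoundedBy c (φ a) :=
  ha.map (T := φ.toAlgHom.toLinearMap) (map_one φ) fun _ h => h.map φ

theorem IsState.abs_re_le {ω : A →ₗ[ℂ] ℂ} (hω : IsState ω) {c : ℝ} {a : A}
    (ha : IsBoundedBy c a) : |(ω a).re| ≤ c ∧ (ω a).im = 0 := by
  obtain ⟨⟨b, hb⟩, ⟨b', hb'⟩⟩ := ha
  have h1 := hω.nonneg b
  have h2 := hω.nonneg b'
  rw [← hb] at h1
  rw [← hb'] at h2
  simp only [map_add, map_sub, map_smul, hω.map_one, Complex.le_def] at h1 h2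
  simp at h1 h2
  exact ⟨abs_le.2 ⟨by linarith [h1.1], by linarith [h2.1]⟩, h1.2.symm⟩

end States

open scoped MatrixOrder Matrix.Norms.L2Operator in
theorem isPos_of_posSemidef {m : Type} [Fintype m] [DecidableEq m]
    {M : Matrix m m ℂ} (hM : M.PosSemidef) : IsPos M :=
  CStarAlgebra.nonneg_iff_eq_star_mul_self.mp hM.nonneg

theorem exists_isBoundedBy {m : Type} [Fintype m] [DecidableEq m] [Nonempty m]
    {M : Matrix m m ℂ} (hM : M.IsHermitian) : ∃ c : ℝ, IsBoundedBy c M := by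
  have key : ∀ N : Matrix m m ℂ, N.IsHermitian → ∃ c : ℝ, ∀ c' : ℝ, c ≤ c' →
      IsPos ((c' : ℂ) • 1 + N) := by
    intro N hN
    obtain ⟨l, v, -, -, hl⟩ := exists_min_eigenvector hN
    refine ⟨-l, fun c' hc => isPos_of_posSemidef ?_⟩
    have h2 : ((c' + l : ℝ) : ℂ) • (1 : Matrix m m ℂ) + (N - (l : ℂ) • 1) = (c' : ℂ) • 1 + N := by
      push_cast
      rw [add_smul]
      abel
    rw [← h2]
    refine (Matrix.PosSemidef.one.smul ?_).add hl
    rw [Complex.zero_le_real]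
    linarith
  obtain ⟨c1, h1⟩ := key M hM
  obtain ⟨c2, h2⟩ := key (-M) hM.neg
  exact ⟨max c1 c2, h1 _ (le_max_left _ _), by simpa [sub_eq_add_neg] using h2 _ (le_max_right _ _)⟩

/-! ### Positivity in C*-algebras -/

section CStar

variable {A : Type} [CStarAlgebra A]

theorem IsPos.add {a b : A} (ha : IsPos a) (hb : IsPos b) : IsPos (a + b) := by
  let _ := CStarAlgebra.spectralOrder A
  have := CStarAlgebra.spectralOrderedRing A
  exact CStarAlgebra.nonneg_iff_eq_star_mul_self.1 (add_nonneg
    (CStarAlgebra.nonneg_iff_eq_star_mul_self.2 ha) (CStarAlgebra.nonneg_iff_eq_star_mul_self.2 hb))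

theorem IsPos.sum {ι : Type} (s : Finset ι) {a : ι → A} (ha : ∀ i ∈ s, IsPos (a i)) :
    IsPos (∑ i ∈ s, a i) :=
  Finset.sum_induction a IsPos (fun _ _ => IsPos.add) ⟨0, by simp⟩ ha

theorem isBoundedBy_norm {a : A} (ha : IsSelfAdjoint a) : IsBoundedBy ‖a‖ a := by
  let _ := CStarAlgebra.spectralOrder A
  have := CStarAlgebra.spectralOrderedRing A
  have h1 : algebraMap ℝ A ‖a‖ = ((‖a‖ : ℝ) : ℂ) • 1 := by
    rw [Algebra.algebraMap_eq_smul_one, Complex.coe_smul]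
  constructor <;> refine CStarAlgebra.nonneg_iff_eq_star_mul_self.1 ?_
  · have := ha.neg_algebraMap_norm_le_self
    rw [h1] at this
    simpa using neg_le_iff_add_nonneg'.1 this
  · have := ha.le_algebraMap_norm_self
    rw [h1] at this
    exact sub_nonneg.2 this

/-- States are bounded; the real part is all that is needed below. -/
theorem IsState.re_le_norm {ω : A →ₗ[ℂ] ℂ} (hω : IsState ω) (a : A) : (ω a).re ≤ ‖a‖ := by
  have h1 := hω.abs_re_le (isBoundedBy_norm (realPart a).2)
  have h2 := hω.abs_re_le (isBoundedBy_norm (imaginaryPart a).2)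
  have h3 : (ω a).re = (ω (realPart a : A)).re := by
    conv_lhs => rw [← realPart_add_I_smul_imaginaryPart a]
    rw [map_add, map_smul, smul_eq_mul, Complex.add_re, Complex.mul_re, h2.2]
    simp
  rw [h3]
  exact (le_abs_self _).trans (h1.1.trans (realPart.norm_le a))

end CStar

section QuasiLocal

variable {d n : ℕ}

instance isClosed_quasiLocal :
    IsClosed (quasiLocal d n : Set (Ambient d n →L[ℂ] Ambient d n)) :=
  (localAlgebra d n).isClosed_topologicalClosure

/-! ### Local perturbations -/

/-- The map `a ↦ ∑ⱼ Kⱼ* a Kⱼ` in Kraus form. -/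
noncomputable def krausMap {ι : Type} [Fintype ι] (K : ι → QL d n) : QL d n →ₗ[ℂ] QL d n :=
  ∑ j, (LinearMap.mulLeft ℂ (star (K j))).comp (LinearMap.mulRight ℂ (K j))

theorem krausMap_apply {ι : Type} [Fintype ι] (K : ι → QL d n) (a : QL d n) :
    krausMap K a = ∑ j, star (K j) * a * K j := by
  simp [krausMap, mul_assoc]

theorem commute_outsideOps {Ω : Finset (Site d)} {a b : QL d n} (ha : a ∈ localOps n Ω)
    (hb : b ∈ outsideOps n Ω) : b * a = a * b := by
  have hc : IsClosed {b : QL d n | b * a = a * b} :=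
    isClosed_eq (continuous_mul_const a) (continuous_const_mul a)
  refine closure_minimal (Set.iUnion_subset fun Z => ?_) hc hb
  obtain ⟨M, rfl⟩ := ha
  rintro _ ⟨N, rfl⟩
  exact (emb_commute_of_disjoint Finset.disjoint_sdiff M N).symm

theorem star_mem_localOps {Ω : Finset (Site d)} {a : QL d n} (ha : a ∈ localOps n Ω) :
    star a ∈ localOps n Ω := by
  obtain ⟨M, rfl⟩ := ha
  exact ⟨star M, map_star _ _⟩

theorem isLocalPerturbation_krausMap {ι : Type} [Fintype ι] {Ω : Finset (Site d)} {K : ι → QL d n}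
    (hK : ∀ j, K j ∈ localOps n Ω) (h1 : ∑ j, star (K j) * K j = 1) :
    IsLocalPerturbation Ω (krausMap K) where
  pos a ha := by
    rw [krausMap_apply]
    obtain ⟨b, rfl⟩ := ha
    exact IsPos.sum _ fun j _ => ⟨b * K j, by simp only [star_mul, mul_assoc]⟩
  fix a ha := by
    rw [krausMap_apply]
    calc ∑ j, star (K j) * a * K j = ∑ j, a * (star (K j) * K j) :=
          Finset.sum_congr rfl fun j _ => by
            rw [← commute_outsideOps (star_mem_localOps (hK j)) ha, mul_assoc]
      _ = a := by rw [← Finset.mul_sum, h1, mul_one]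

theorem IsLocalPerturbation.fix_local {Ω Z : Finset (Site d)} {T : QL d n →ₗ[ℂ] QL d n}
    (hT : IsLocalPerturbation Ω T) (hd : Disjoint Ω Z) {a : QL d n} (ha : a ∈ localOps n Z) :
    T a = a := hT.fix a (localOps_subset_outsideOps hd ha)

theorem IsLocalPerturbation.map_one {Ω : Finset (Site d)} {T : QL d n →ₗ[ℂ] QL d n}
    (hT : IsLocalPerturbation Ω T) : T 1 = 1 :=
  hT.fix_local (Finset.disjoint_empty_right Ω) (one_mem_localOps ∅)

theorem IsState.comp_perturbation {ω : QL d n →ₗ[ℂ] ℂ} (hω : IsState ω) {Ω : Finset (Site d)}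
    {T : QL d n →ₗ[ℂ] QL d n} (hT : IsLocalPerturbation Ω T) : IsState (ω ∘ₗ T) :=
  hω.comp hT.map_one hT.pos

/-- The translated map `τ_x T τ_{-x}`. -/
noncomputable def translateMap (x : Site d) (T : QL d n →ₗ[ℂ] QL d n) : QL d n →ₗ[ℂ] QL d n :=
  (tau x).toAlgHom.toLinearMap ∘ₗ T ∘ₗ (tau (-x)).toAlgHom.toLinearMap

theorem translateMap_apply (x : Site d) (T : QL d n →ₗ[ℂ] QL d n) (a : QL d n) :
    translateMap x T a = tau x (T (tau (-x) a)) := rfl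

theorem tau_tau_neg (x : Site d) (a : QL d n) : tau x (tau (-x) a) = a := by
  rw [tau_tau, add_neg_cancel, tau_zero]

theorem tau_neg_tau (x : Site d) (a : QL d n) : tau (-x) (tau x a) = a := by
  rw [tau_tau, neg_add_cancel, tau_zero]

theorem continuous_tau (x : Site d) : Continuous (tau (n := n) x) :=
  Continuous.subtype_mk (((continuous_const.mul continuous_id).mul continuous_const).comp
    continuous_subtype_val) _

theorem IsLocalPerturbation.translate {Ω : Finset (Site d)} {T : QL d n →ₗ[ℂ] QL d n}
    (hT : IsLocalPerturbation Ω T) (x : Site d) :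
    IsLocalPerturbation (translate x Ω) (translateMap x T) where
  pos a ha := (hT.pos _ (ha.map (tau (-x)))).map (tau x)
  fix a ha := by
    have h : tau (-x) a ∈ outsideOps n Ω := by
      refine map_mem_closure (continuous_tau (-x)) ha ?_
      intro b hb
      obtain ⟨Z, hb⟩ := Set.mem_iUnion.1 hb
      refine Set.mem_iUnion.2 ⟨SpinLattice.translate (-x) Z, ?_⟩
      refine localOps_mono ?_ (tau_mem_localOps hb)
      intro y
      simp [mem_translate]
    rw [translateMap_apply, hT.fix _ h, tau_tau_neg]

/-! ### Local Hamiltonians -/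

section Hamiltonian

variable (S : Finset (Site d)) (h : Op n S)

theorem localHam_mem (x : Site d) : localHam S h x ∈ localOps n (translate x S) :=
  tau_mem_localOps ⟨h, rfl⟩

theorem tau_localHam (x y : Site d) : tau x (localHam S h y) = localHam S h (x + y) :=
  tau_tau _ _ _

theorem tau_ham (x : Site d) (Λ : Finset (Site d)) :
    tau x (ham S h Λ) = ham S h (translate x Λ) := by
  simp [ham, tau_localHam, translate, add_comm]

variable {S h}

theorem isBoundedBy_localHam {c : ℝ} (hc : IsBoundedBy c h) (x : Site d) :
    IsBoundedBy c (localHam S h x) := (hc.map_starAlgHom _).map_starAlgHom _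

theorem IsLocalPerturbation.map_localHam {Ω : Finset (Site d)} {T : QL d n →ₗ[ℂ] QL d n}
    (hT : IsLocalPerturbation Ω T) {x : Site d} (hx : x ∉ enlarge S Ω) :
    T (localHam S h x) = localHam S h x := by
  refine hT.fix_local ?_ (localHam_mem S h x)
  rw [mem_enlarge, Finset.not_nonempty_iff_eq_empty] at hx
  rwa [disjoint_comm, Finset.disjoint_iff_inter_eq_empty]

/-- The energy change caused by a perturbation on `Ω` does not depend on the region, as long as it
contains every `x` whose `h_x` touches `Ω`. -/
theorem IsLocalPerturbation.map_ham_sub {Ω Λ : Finset (Site d)} {T : QL d n →ₗ[ℂ] QL d n}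
    (hT : IsLocalPerturbation Ω T) (hΛ : enlarge S Ω ⊆ Λ) :
    T (ham S h Λ) - ham S h Λ = T (ham S h (enlarge S Ω)) - ham S h (enlarge S Ω) := by
  simp only [ham, map_sum, ← Finset.sum_sub_distrib]
  refine (Finset.sum_subset hΛ fun x _ hx => ?_).symm
  rw [hT.map_localHam hx, sub_self]

theorem translate_enlarge (x : Site d) (Ω : Finset (Site d)) :
    enlarge S (translate x Ω) = translate x (enlarge S Ω) := by
  ext y
  simp only [mem_enlarge, mem_translate, Finset.Nonempty, Finset.mem_inter]
  constructor
  · rintro ⟨z, h1, h2⟩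
    exact ⟨z - x, by rwa [show z - x - (y - x) = z - y by abel], h2⟩
  · rintro ⟨z, h1, h2⟩
    exact ⟨z + x, by rwa [show z + x - y = z - (y - x) by abel], by simpa using h2⟩

theorem IsState.ham_re_le {ω : QL d n →ₗ[ℂ] ℂ} (hω : IsState ω) {c : ℝ} (hc : IsBoundedBy c h)
    (Λ : Finset (Site d)) : |(ω (ham S h Λ)).re| ≤ c * Λ.card ∧ (ω (ham S h Λ)).im = 0 := by
  constructor
  · rw [ham, map_sum, Complex.re_sum]
    refine (Finset.abs_sum_le_sum_abs _ _).trans ?_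
    refine (Finset.sum_le_card_nsmul _ _ c fun x _ =>
      (hω.abs_re_le (isBoundedBy_localHam hc x)).1).trans ?_
    rw [nsmul_eq_mul, mul_comm]
  · rw [ham, map_sum, Complex.im_sum]
    exact Finset.sum_eq_zero fun x _ => (hω.abs_re_le (isBoundedBy_localHam hc x)).2

/-! ### Stability under perturbations in Kraus form -/

/-- Local perturbations of the form `a ↦ ∑ⱼ Kⱼ* a Kⱼ`, with Kraus operators on `Ω`, do not lower the
energy of `ω`. This is a common consequence of the first two notions of ground state. -/
def IsKrausStable (S : Finset (Site d)) (h : Op n S) (ω : QL d n →ₗ[ℂ] ℂ) : Prop :=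
  ∀ (Ω : Finset (Site d)) (ι : Type) [Fintype ι] (K : ι → QL d n), (∀ j, K j ∈ localOps n Ω) →
    ∑ j, star (K j) * K j = 1 →
    (ω (ham S h (enlarge S Ω))).re ≤ (ω (krausMap K (ham S h (enlarge S Ω)))).re

/-- Since `∑ⱼ Kⱼ* Kⱼ = 1`, the energy change is `∑ⱼ ω(Kⱼ* [H, Kⱼ])`. -/
theorem isKrausStable_of_mem_groundStates₁ {ω : QL d n →ₗ[ℂ] ℂ} (hω : ω ∈ GroundStates₁ S h) :
    IsKrausStable S h ω := by
  intro Ω ι _ K hK h1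
  set H := ham S h (enlarge S Ω)
  have h2 : 0 ≤ ∑ j, ω (star (K j) * (H * K j - K j * H)) :=
    Finset.sum_nonneg fun j _ => hω.2 Ω (K j) (hK j)
  have h3 : ∑ j, ω (star (K j) * (H * K j - K j * H)) = ω (krausMap K H) - ω H := by
    rw [← map_sum, ← map_sub]
    congr 1
    rw [krausMap_apply]
    simp only [mul_sub, ← mul_assoc, Finset.sum_sub_distrib]
    rw [← Finset.sum_mul, h1, one_mul]
  rw [h3, sub_nonneg] at h2
  exact (Complex.le_def.1 h2).1

theorem isKrausStable_of_mem_groundStates₂ {ω : QL d n →ₗ[ℂ] ℂ} (hω : ω ∈ GroundStates₂ S h) :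
    IsKrausStable S h ω := fun Ω _ _ K hK h1 =>
  (Complex.le_def.1 (hω.2 Ω (krausMap K) (isLocalPerturbation_krausMap hK h1))).1

theorem IsKrausStable.le_of_subset {ω : QL d n →ₗ[ℂ] ℂ} (hω : IsKrausStable S h ω)
    {Ω Λ : Finset (Site d)} (hΛ : enlarge S Ω ⊆ Λ) {ι : Type} [Fintype ι] {K : ι → QL d n}
    (hK : ∀ j, K j ∈ localOps n Ω) (h1 : ∑ j, star (K j) * K j = 1) :
    (ω (ham S h Λ)).re ≤ (ω (krausMap K (ham S h Λ))).re := by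
  have h2 := hω Ω ι K hK h1
  have h3 := congrArg (fun a => (ω a).re)
    ((isLocalPerturbation_krausMap hK h1).map_ham_sub (h := h) hΛ)
  simp only [map_sub, Complex.sub_re] at h3
  linarith

end Hamiltonian

end QuasiLocal

/-! ### Stable states satisfy the commutator condition -/

section CStar

variable {A : Type} [CStarAlgebra A]

theorem IsState.map_star {ω : A →ₗ[ℂ] ℂ} (hω : IsState ω) (a : A) : ω (star a) = star (ω a) := by
  have h1 := (hω.abs_re_le (isBoundedBy_norm (realPart a).2)).2
  have h2 := (hω.abs_re_le (isBoundedBy_norm (imaginaryPart a).2)).2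
  have h1' : star (ω (realPart a : A)) = ω (realPart a : A) := Complex.conj_eq_iff_im.2 h1
  have h2' : star (ω (imaginaryPart a : A)) = ω (imaginaryPart a : A) := Complex.conj_eq_iff_im.2 h2
  have h3 : star a = (realPart a : A) - Complex.I • (imaginaryPart a : A) := by
    conv_lhs => rw [← realPart_add_I_smul_imaginaryPart a]
    rw [star_add, star_smul, (realPart a).2.star_eq, (imaginaryPart a).2.star_eq]
    simp [sub_eq_add_neg]
  conv_rhs => rw [← realPart_add_I_smul_imaginaryPart a]
  rw [h3, map_sub, map_add, map_smul, star_add, smul_eq_mul, star_mul, h1', h2', sub_eq_add_neg]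
  simp [mul_comm]

theorem IsState.continuous_re {ω : A →ₗ[ℂ] ℂ} (hω : IsState ω) :
    Continuous fun a => (ω a).re := by
  let f : A →+ ℝ := Complex.reAddGroupHom.comp ω.toAddMonoidHom
  refine AddMonoidHomClass.continuous_of_bound f 1 fun a => ?_
  rw [one_mul, Real.norm_eq_abs, abs_le]
  have h2 := hω.re_le_norm (-a)
  rw [map_neg, norm_neg, Complex.neg_re] at h2
  exact ⟨by change -‖a‖ ≤ (ω a).re; linarith, hω.re_le_norm a⟩

end CStar

section Kraus

variable {A : Type} [Ring A] [StarRing A] [Algebra ℂ A]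

/-- The two Kraus operators `(1 - t a*a) r` and `2 √t a r`, where `r = (1 + t a*a)⁻¹`; the first
one equals `1 - 2t a*a r`. -/
noncomputable def krausPair (t : ℝ) (a r : A) (i : Bool) : A :=
  if i then 1 - (2 * t : ℂ) • (star a * a * r) else ((2 * Real.sqrt t : ℝ) : ℂ) • (a * r)

variable {t : ℝ} {a r : A}

theorem commute_of_resolvent (ht : 0 < t) (h1 : (1 + (t : ℂ) • (star a * a)) * r = 1)
    (h2 : r * (1 + (t : ℂ) • (star a * a)) = 1) : star a * a * r = r * (star a * a) := by
  rw [add_mul, one_mul, smul_mul_assoc] at h1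
  rw [mul_add, mul_one, mul_smul_comm] at h2
  have h3 : (t : ℂ) • (star a * a * r) = (t : ℂ) • (r * (star a * a)) :=
    add_left_cancel (h1.trans h2.symm)
  have ht' : (t : ℂ) ≠ 0 := by exact_mod_cast ht.ne'
  rw [← one_smul ℂ (star a * a * r), ← one_smul ℂ (r * (star a * a)), ← inv_mul_cancel₀ ht',
    mul_smul, mul_smul, h3]

theorem star_resolvent [StarModule ℂ A] (h1 : (1 + (t : ℂ) • (star a * a)) * r = 1) :
    star r = r := by
  have h3 : star r * (1 + (t : ℂ) • (star a * a)) = 1 := by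
    have := congrArg star h1
    rw [star_mul, star_add, star_smul, star_mul, star_star, star_one] at this
    simpa using this
  calc star r = star r * ((1 + (t : ℂ) • (star a * a)) * r) := by rw [h1, mul_one]
    _ = r := by rw [← mul_assoc, h3, one_mul]

theorem two_sqrt_mul_self (ht : 0 < t) :
    star ((2 * Real.sqrt t : ℝ) : ℂ) * ((2 * Real.sqrt t : ℝ) : ℂ) = 4 * (t : ℂ) := by
  rw [Complex.star_def, Complex.conj_ofReal, ← Complex.ofReal_mul,
    show 2 * √t * (2 * √t) = 4 * (√t * √t) by ring, Real.mul_self_sqrt ht.le]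
  push_cast; ring

theorem star_krausPair_true [StarModule ℂ A] (ht : 0 < t)
    (h1 : (1 + (t : ℂ) • (star a * a)) * r = 1)
    (h2 : r * (1 + (t : ℂ) • (star a * a)) = 1) :
    star (krausPair t a r true) = krausPair t a r true := by
  have h3 : star (star a * a * r) = star a * a * r := by
    rw [star_mul, star_mul, star_star, star_resolvent h1, commute_of_resolvent ht h1 h2]
  simp only [krausPair, if_true, star_sub, star_one, star_smul, h3]
  simp

theorem krausPair_sum [StarModule ℂ A] (ht : 0 < t) (h1 : (1 + (t : ℂ) • (star a * a)) * r = 1)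
    (h2 : r * (1 + (t : ℂ) • (star a * a)) = 1) :
    ∑ i, star (krausPair t a r i) * krausPair t a r i = 1 := by
  rw [Fintype.sum_bool, star_krausPair_true ht h1 h2]
  simp only [krausPair, if_true, Bool.false_eq_true, if_false]
  rw [star_smul, star_mul, star_resolvent h1, smul_mul_smul_comm, two_sqrt_mul_self ht]
  have hr : r = 1 - (t : ℂ) • (star a * a * r) := by
    rw [add_mul, one_mul, smul_mul_assoc] at h1
    exact eq_sub_of_add_eq h1
  have h3 : r * star a * (a * r)
      = star a * a * r - (t : ℂ) • (star a * a * r * (star a * a * r)) := by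
    calc r * star a * (a * r) = r * (star a * a) * r := by simp only [mul_assoc]
      _ = star a * a * r * r := by rw [commute_of_resolvent ht h1 h2]
      _ = star a * a * r * (1 - (t : ℂ) • (star a * a * r)) := by rw [← hr]
      _ = _ := by rw [mul_sub, mul_one, mul_smul_comm]
  rw [h3]
  generalize star a * a * r = x
  simp only [sub_mul, mul_sub, one_mul, mul_one, smul_mul_assoc, mul_smul_comm]
  module

theorem krausPair_apply [StarModule ℂ A] (ht : 0 < t) (h1 : (1 + (t : ℂ) • (star a * a)) * r = 1)
    (h2 : r * (1 + (t : ℂ) • (star a * a)) = 1) (H : A) :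
    ∑ i, star (krausPair t a r i) * H * krausPair t a r i - H
      = (4 * t : ℂ) • (r * (star a * H * a) * r) - (2 * t : ℂ) • (r * (star a * a) * H)
        - (2 * t : ℂ) • (H * (star a * a) * r)
        + (4 * t * t : ℂ) • (r * (star a * a) * H * (star a * a) * r) := by
  rw [Fintype.sum_bool, star_krausPair_true ht h1 h2]
  simp only [krausPair, if_true, Bool.false_eq_true, if_false]
  rw [star_smul, star_mul, star_resolvent h1, smul_mul_assoc, smul_mul_smul_comm,
    two_sqrt_mul_self ht, commute_of_resolvent ht h1 h2]
  have h3 : r * (star a * a) * H * (star a * a) * r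
      = r * (star a * a) * H * (r * (star a * a)) := by
    rw [mul_assoc _ _ r, commute_of_resolvent ht h1 h2]
  have h4 : r * star a * H * (a * r) = r * (star a * H * a) * r := by simp only [mul_assoc]
  rw [h3, mul_assoc H _ r, commute_of_resolvent ht h1 h2, h4]
  generalize r * (star a * a) = x
  simp only [sub_mul, mul_sub, one_mul, mul_one, smul_mul_assoc, mul_smul_comm, ← mul_assoc]
  module

end Kraus

section CStar

variable {A : Type} [CStarAlgebra A]

open Filter Topology in
/-- If the perturbations `krausPair t a r` do not lower the expectation of `H`, then neither
does `a` to first order. -/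
theorem IsState.re_commutator_nonneg {ω : A →ₗ[ℂ] ℂ} (hω : IsState ω) {H : A}
    (hH : IsSelfAdjoint H) {a : A} (hs : ∀ t : ℝ, 0 < t → ∃ r : A,
      (1 + (t : ℂ) • (star a * a)) * r = 1 ∧ r * (1 + (t : ℂ) • (star a * a)) = 1 ∧
      (ω H).re ≤ (ω (∑ i, star (krausPair t a r i) * H * krausPair t a r i)).re) :
    0 ≤ (ω (star a * (H * a - a * H))).re := by
  have hHsa : star H = H := hH
  let r : ℝ → A := fun t => Ring.inverse (1 + (t : ℂ) • (star a * a))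
  -- `4 t g(t)` is the energy change caused by `krausPair t a (r t)`
  let g : ℝ → ℝ := fun t => (ω (r t * (star a * H * a) * r t)).re
    - (ω (r t * (star a * a) * H)).re / 2
    - (ω (H * (star a * a) * r t)).re / 2
    + t * (ω (r t * (star a * a) * H * (star a * a) * r t)).re
  have hr : ContinuousAt r 0 := by
    have h1 : ContinuousAt (fun t : ℝ => 1 + (t : ℂ) • (star a * a)) 0 := by fun_prop
    have h2 : ContinuousAt Ring.inverse ((fun t : ℝ => 1 + (t : ℂ) • (star a * a)) 0) := by
      simpa using NormedRing.inverse_continuousAt (1 : Aˣ)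
    exact ContinuousAt.comp (f := fun t : ℝ => 1 + (t : ℂ) • (star a * a)) h2 h1
  have hg : ContinuousAt g 0 := by
    have hc := hω.continuous_re
    have h1 : ContinuousAt (fun t => (ω (r t * (star a * H * a) * r t)).re) 0 :=
      hc.continuousAt.comp ((hr.mul continuousAt_const).mul hr)
    have h2 : ContinuousAt (fun t => (ω (r t * (star a * a) * H)).re) 0 :=
      hc.continuousAt.comp ((hr.mul continuousAt_const).mul continuousAt_const)
    have h3 : ContinuousAt (fun t => (ω (H * (star a * a) * r t)).re) 0 :=
      hc.continuousAt.comp (continuousAt_const.mul hr)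
    have h4 : ContinuousAt (fun t => (ω (r t * (star a * a) * H * (star a * a) * r t)).re) 0 :=
      hc.continuousAt.comp ((((hr.mul continuousAt_const).mul continuousAt_const).mul
        continuousAt_const).mul hr)
    exact ((h1.sub (h2.div_const 2)).sub (h3.div_const 2)).add (continuousAt_id.mul h4)
  have hg0 : g 0 = (ω (star a * (H * a - a * H))).re := by
    have h1 : r 0 = 1 := by simp [r]
    have h2 : (ω (H * (star a * a))).re = (ω (star a * a * H)).re := by
      have := hω.map_star (star a * a * H)
      rw [star_mul, hHsa, star_mul, star_star] at this
      rw [this]; simp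
    simp only [g, h1, one_mul, mul_one, zero_mul, add_zero, h2]
    rw [mul_sub, map_sub, Complex.sub_re, ← mul_assoc, ← mul_assoc]
    ring
  rw [← hg0]
  refine ge_of_tendsto (hg.tendsto.mono_left (nhdsWithin_le_nhds (s := Set.Ioi 0))) ?_
  filter_upwards [self_mem_nhdsWithin] with t ht
  have ht : 0 < t := ht
  obtain ⟨q, e1, e2, hst⟩ := hs t ht
  have hrq : r t = q := Ring.inverse_unit (⟨1 + (t : ℂ) • (star a * a), q, e1, e2⟩ : Aˣ)
  rw [sub_eq_iff_eq_add.1 (krausPair_apply ht e1 e2 H)] at hst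
  have c1 : (4 * t : ℂ) = ((4 * t : ℝ) : ℂ) := by push_cast; ring
  have c2 : (2 * t : ℂ) = ((2 * t : ℝ) : ℂ) := by push_cast; ring
  rw [c1, c2, ← Complex.ofReal_mul] at hst
  simp only [map_sub, map_add, map_smul, smul_eq_mul, Complex.sub_re, Complex.add_re,
    Complex.re_ofReal_mul] at hst
  have h4 : 0 ≤ 4 * t * g t := by
    simp only [g, hrq]
    linarith [hst]
  exact nonneg_of_mul_nonneg_right h4 (by positivity)

end CStar

section Commutator

variable {d n : ℕ} {S : Finset (Site d)} {h : Op n S}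

theorem isSelfAdjoint_ham (hh : h.IsHermitian) (Λ : Finset (Site d)) :
    IsSelfAdjoint (ham S h Λ) := by
  refine isSelfAdjoint_sum _ fun x _ => ?_
  rw [isSelfAdjoint_iff, localHam, ← StarHomClass.map_star, ← StarHomClass.map_star]
  rw [show star h = h from hh]

/-- The matrix `1 + t M* M`, `t ≥ 0`, is invertible. -/
theorem isUnit_one_add_smul {m : Type} [Fintype m] [DecidableEq m] (M : Matrix m m ℂ) {t : ℝ}
    (ht : 0 ≤ t) : IsUnit (1 + (t : ℂ) • (star M * M)) :=
  (Matrix.PosDef.one.add_posSemidef ((Matrix.posSemidef_conjTranspose_mul_self M).smul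
    (Complex.zero_le_real.2 ht))).isUnit

/-- Apply stability to the two Kraus operators of `krausPair` and differentiate at `t = 0`. -/
theorem IsKrausStable.re_nonneg {ω : QL d n →ₗ[ℂ] ℂ} (hω : IsState ω) (hh : h.IsHermitian)
    (hs : IsKrausStable S h ω) (Ω : Finset (Site d)) {a : QL d n} (ha : a ∈ localOps n Ω) :
    0 ≤ (ω (star a * (ham S h (enlarge S Ω) * a - a * ham S h (enlarge S Ω)))).re := by
  refine hω.re_commutator_nonneg (isSelfAdjoint_ham hh _) fun t ht => ?_
  obtain ⟨M, rfl⟩ := ha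
  -- the inverse is again an operator on `Ω`
  obtain ⟨u, hu⟩ := isUnit_one_add_smul M ht.le
  let R : Op n Ω := ↑u⁻¹
  have hM : emb Ω (1 + (t : ℂ) • (star M * M))
      = 1 + (t : ℂ) • (star (emb Ω M) * emb Ω M) := by
    rw [map_add, map_one, map_smul, map_mul, StarHomClass.map_star]
  have e1 : (1 + (t : ℂ) • (star (emb Ω M) * emb Ω M)) * emb Ω R = 1 := by
    rw [← hM, ← map_mul, ← hu, u.mul_inv, map_one]
  have e2 : emb Ω R * (1 + (t : ℂ) • (star (emb Ω M) * emb Ω M)) = 1 := by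
    rw [← hM, ← map_mul, ← hu, u.inv_mul, map_one]
  have hK : ∀ i, krausPair t (emb Ω M) (emb Ω R) i ∈ localOps n Ω := by
    rintro (_ | _)
    · exact ⟨krausPair t M R false, by simp [krausPair]⟩
    · exact ⟨krausPair t M R true, by simp [krausPair, StarHomClass.map_star]⟩
  have hst := hs Ω Bool _ hK (krausPair_sum ht e1 e2)
  rw [krausMap_apply] at hst
  exact ⟨emb Ω R, e1, e2, hst⟩

/-- Stability gives the real part of the commutator condition; the imaginary part vanishes because
`ω` annihilates all `[H, b]`, in particular `[H, a*a]`. -/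
theorem IsKrausStable.mem_groundStates₁ {ω : QL d n →ₗ[ℂ] ℂ} (hω : IsState ω) (hh : h.IsHermitian)
    (hs : IsKrausStable S h ω) : ω ∈ GroundStates₁ S h := by
  refine ⟨hω, fun Ω a ha => ?_⟩
  set H := ham S h (enlarge S Ω) with hH
  have hHsa : star H = H := isSelfAdjoint_ham hh _
  -- polarization with `z + b` shows that `ω` vanishes on the commutators `[H, b]`
  have hcomm : ∀ b ∈ localOps n Ω, ω (H * b - b * H) = 0 := by
    rintro _ ⟨M, rfl⟩
    set b := emb Ω M
    set w := ω (H * b - b * H) with hw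
    by_contra hne
    -- take `z = -s w` with `s` real and large
    have hpos : 0 < Complex.normSq w := Complex.normSq_pos.2 hne
    have key : ∀ s : ℝ, 0 ≤ -s * Complex.normSq w + (ω (star b * (H * b - b * H))).re := by
      intro s
      have h1 := hs.re_nonneg hω hh Ω (a := (-(s : ℂ) * w) • 1 + b)
        ⟨(-(s : ℂ) * w) • 1 + M, by simp [b]⟩
      rw [← hH] at h1
      have h2 : star ((-(s : ℂ) * w) • (1 : QL d n) + b) * (H * ((-(s : ℂ) * w) • 1 + b)
          - ((-(s : ℂ) * w) • 1 + b) * H)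
          = (-(s : ℂ) * star w) • (H * b - b * H) + star b * (H * b - b * H) := by
        have hz : star (-(s : ℂ) * w) = -(s : ℂ) * star w := by simp
        rw [star_add, star_smul, star_one, hz]
        simp only [mul_add, mul_sub, add_mul, smul_mul_assoc, mul_smul_comm, one_mul, mul_one]
        module
      rw [h2, map_add, map_smul, ← hw, smul_eq_mul, mul_assoc, Complex.star_def,
        ← Complex.normSq_eq_conj_mul_self, Complex.add_re, ← Complex.ofReal_neg,
        ← Complex.ofReal_mul, Complex.ofReal_re] at h1
      exact h1
    have h1 := key (((ω (star b * (H * b - b * H))).re + 1) / Complex.normSq w)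
    rw [neg_mul, div_mul_cancel₀ _ hpos.ne'] at h1
    linarith
  have him : (ω (star a * (H * a - a * H))).im = 0 := by
    have h1 : (ω (star a * H * a)).im = 0 := by
      have := hω.map_star (star a * H * a)
      rw [star_mul, star_mul, star_star, hHsa, ← mul_assoc] at this
      exact Complex.conj_eq_iff_im.1 this.symm
    have h2 : (ω (star a * a * H)).im = 0 := by
      have e1 := hω.map_star (star a * a * H)
      have e2 := hcomm (star a * a) (by
        obtain ⟨M, rfl⟩ := ha
        exact ⟨star M * M, by rw [map_mul, StarHomClass.map_star]⟩)
      rw [map_sub, sub_eq_zero] at e2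
      rw [star_mul, star_mul, star_star, hHsa, e2] at e1
      exact Complex.conj_eq_iff_im.1 e1.symm
    rw [mul_sub, map_sub, Complex.sub_im, ← mul_assoc, ← mul_assoc, h1, h2, sub_zero]
  exact Complex.le_def.2 ⟨hs.re_nonneg hω hh Ω ha, him.symm⟩

end Commutator

section Box

variable {d n : ℕ}

/-! ### Boxes -/

/-- The box `[a, b)^d`. -/
noncomputable def box (d : ℕ) (a b : ℤ) : Finset (Site d) :=
  Fintype.piFinset fun _ => Finset.Ico a b

theorem mem_box {a b : ℤ} {x : Site d} : x ∈ box d a b ↔ ∀ i, a ≤ x i ∧ x i < b := by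
  simp [box]

theorem card_box {a b : ℤ} (h : a ≤ b) : ((box d a b).card : ℝ) = ((b : ℝ) - a) ^ d := by
  have h1 : (((b - a).toNat : ℤ) : ℝ) = (b : ℝ) - a := by
    rw [Int.toNat_of_nonneg (by omega)]; push_cast; ring
  simp only [box, Fintype.card_piFinset, Int.card_Ico, Finset.prod_const, Finset.card_univ,
    Fintype.card_fin]
  rw [← h1]
  push_cast
  rfl

theorem box_subset {a b a' b' : ℤ} (h1 : a' ≤ a) (h2 : b ≤ b') : box d a b ⊆ box d a' b' := by
  intro x hx
  rw [mem_box] at hx ⊢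
  exact fun i => ⟨h1.trans (hx i).1, (hx i).2.trans_le h2⟩

theorem exists_subset_box (Z : Finset (Site d)) : ∃ B : ℕ, Z ⊆ box d (-B) (B + 1) := by
  refine ⟨∑ x ∈ Z, ∑ i, (x i).natAbs, fun x hx => mem_box.2 fun i => ?_⟩
  have h1 : (x i).natAbs ≤ ∑ i, (x i).natAbs :=
    Finset.single_le_sum (f := fun i => (x i).natAbs) (fun _ _ => Nat.zero_le _)
      (Finset.mem_univ i)
  have h2 : ∑ i, (x i).natAbs ≤ ∑ x ∈ Z, ∑ i, (x i).natAbs :=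
    Finset.single_le_sum (f := fun x => ∑ i, (x i).natAbs) (fun _ _ => Nat.zero_le _) hx
  lia

/-- The box of side `k L` is tiled by `k ^ d` boxes of side `L`. -/
theorem sum_box_mul (f : Site d → ℝ) (k L : ℕ) (hL : 0 < L) :
    ∑ y ∈ box d 0 (k * L : ℕ), f y
      = ∑ j ∈ box d 0 k, ∑ z ∈ box d 0 L, f ((L : ℤ) • j + z) := by
  have hL' : (0 : ℤ) < L := by exact_mod_cast hL
  rw [← Finset.sum_product']
  refine Finset.sum_bij' (fun y _ => (fun i => y i / L, fun i => y i % L))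
    (fun p _ => (L : ℤ) • p.1 + p.2) ?_ ?_ ?_ ?_ ?_
  · intro y hy
    rw [mem_box] at hy
    refine Finset.mem_product.2 ⟨mem_box.2 fun i => ⟨Int.ediv_nonneg (hy i).1 hL'.le, ?_⟩,
      mem_box.2 fun i => ⟨Int.emod_nonneg _ hL'.ne', Int.emod_lt_of_pos _ hL'⟩⟩
    rw [Int.ediv_lt_iff_lt_mul hL']
    exact_mod_cast (hy i).2
  · rintro ⟨j, z⟩ hp
    obtain ⟨hj, hz⟩ := Finset.mem_product.1 hp
    rw [mem_box] at hj hz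
    refine mem_box.2 fun i => ?_
    have h1 := hj i
    have h2 := hz i
    simp only [Pi.add_apply, Pi.smul_apply, smul_eq_mul]
    push_cast
    constructor
    · nlinarith
    · nlinarith
  · intro y _
    funext i
    exact Int.mul_ediv_add_emod _ _
  · rintro ⟨j, z⟩ hp
    obtain ⟨-, hz⟩ := Finset.mem_product.1 hp
    rw [mem_box] at hz
    refine Prod.ext (funext fun i => ?_) (funext fun i => ?_)
    · simp only [Pi.add_apply, Pi.smul_apply, smul_eq_mul]
      rw [Int.mul_add_ediv_left _ _ hL'.ne', Int.ediv_eq_zero_of_lt (hz i).1 (hz i).2, add_zero]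
    · simp only [Pi.add_apply, Pi.smul_apply, smul_eq_mul]
      rw [Int.mul_add_emod_self_left, Int.emod_eq_of_lt (hz i).1 (hz i).2]
  · intro y _
    congr 1
    funext i
    exact (Int.mul_ediv_add_emod _ _).symm

/-! ### The minimal energy of a finite region -/

/-- The vector state of a basis vector of the ambient space. -/
theorem exists_isState [NeZero n] : ∃ ω : QL d n →ₗ[ℂ] ℂ, IsState ω := by
  classical
  let ψ : Ambient d n := lp.single 2 (fun _ => 0) (1 : ℂ)
  have hψ : inner ℂ ψ ψ = (1 : ℂ) := by
    rw [lp.inner_single_left]; simp [ψ]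
  refine ⟨{ toFun := fun a => inner ℂ ψ ((a : Ambient d n →L[ℂ] Ambient d n) ψ)
            map_add' := fun a b => ?_
            map_smul' := fun c a => ?_ }, ?_, fun a => ?_⟩
  · change inner ℂ ψ ((a : Ambient d n →L[ℂ] Ambient d n) ψ + (b : Ambient d n →L[ℂ] Ambient d n) ψ)
      = _
    rw [inner_add_right]
  · change inner ℂ ψ (c • (a : Ambient d n →L[ℂ] Ambient d n) ψ) = _
    rw [inner_smul_right]
    rfl
  · exact hψ
  · change 0 ≤ inner ℂ ψ (ContinuousLinearMap.adjoint (a : Ambient d n →L[ℂ] Ambient d n)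
      ((a : Ambient d n →L[ℂ] Ambient d n) ψ))
    rw [ContinuousLinearMap.adjoint_inner_right, inner_self_eq_norm_sq_to_K]
    have : (0 : ℝ) ≤ ‖(a : Ambient d n →L[ℂ] Ambient d n) ψ‖ ^ 2 := by positivity
    exact Complex.zero_le_real.2 this |>.trans_eq (by push_cast; rfl)

/-- The infimum of the energy `ω(H_Λ)` over all states `ω` of the quasi-local algebra. -/
noncomputable def minEnergy (S : Finset (Site d)) (h : Op n S) (Λ : Finset (Site d)) : ℝ :=
  sInf {e : ℝ | ∃ ω : QL d n →ₗ[ℂ] ℂ, IsState ω ∧ e = (ω (ham S h Λ)).re}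

variable {S : Finset (Site d)} {h : Op n S} {c : ℝ}

theorem minEnergy_le (hc : IsBoundedBy c h) {ω : QL d n →ₗ[ℂ] ℂ} (hω : IsState ω)
    (Λ : Finset (Site d)) : minEnergy S h Λ ≤ (ω (ham S h Λ)).re := by
  refine csInf_le ⟨-(c * Λ.card), ?_⟩ ⟨ω, hω, rfl⟩
  rintro _ ⟨ω', hω', rfl⟩
  exact (abs_le.1 (hω'.ham_re_le hc Λ).1).1

theorem le_minEnergy [NeZero n] {e : ℝ} {Λ : Finset (Site d)}
    (he : ∀ ω : QL d n →ₗ[ℂ] ℂ, IsState ω → e ≤ (ω (ham S h Λ)).re) : e ≤ minEnergy S h Λ := by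
  obtain ⟨ω, hω⟩ := exists_isState (d := d) (n := n)
  refine le_csInf ⟨_, ω, hω, rfl⟩ ?_
  rintro _ ⟨ω', hω', rfl⟩
  exact he ω' hω'

/-- Translation invariance of the minimal energy, in the form used along a tiling. -/
theorem minEnergy_le_translate (hc : IsBoundedBy c h) {ω : QL d n →ₗ[ℂ] ℂ} (hω : IsState ω)
    (x : Site d) (Λ : Finset (Site d)) :
    minEnergy S h Λ ≤ ∑ z ∈ Λ, (ω (localHam S h (x + z))).re := by
  refine (minEnergy_le hc (hω.comp_starAlgHom (tau x)) Λ).trans_eq ?_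
  change (ω (tau x (ham S h Λ))).re = _
  simp [ham, tau_localHam]

theorem ham_re_eq_sum (ω : QL d n →ₗ[ℂ] ℂ) (Λ : Finset (Site d)) :
    (ω (ham S h Λ)).re = ∑ x ∈ Λ, (ω (localHam S h x)).re := by
  simp [ham]

theorem ham_sub_ham {Λ Λ' : Finset (Site d)} (hΛ : Λ ⊆ Λ') :
    ham S h Λ' = ham S h Λ + ham S h (Λ' \ Λ) := by
  rw [ham, ham, ham, add_comm, Finset.sum_sdiff hΛ]

/-- Enlarging the region changes the energy of a state by at most `c` per added site. -/
theorem IsState.abs_ham_sub_le {ω : QL d n →ₗ[ℂ] ℂ} (hω : IsState ω) (hc : IsBoundedBy c h)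
    {Λ Λ' : Finset (Site d)} (hΛ : Λ ⊆ Λ') :
    |(ω (ham S h Λ')).re - (ω (ham S h Λ)).re| ≤ c * (Λ'.card - Λ.card) := by
  have h1 := (hω.ham_re_le hc (Λ' \ Λ)).1
  have h2 : ((Λ' \ Λ).card : ℝ) = Λ'.card - Λ.card := Finset.cast_card_sdiff hΛ
  rwa [h2, show (ω (ham S h (Λ' \ Λ))).re = (ω (ham S h Λ')).re - (ω (ham S h Λ)).re by
    rw [ham_sub_ham hΛ, map_add, Complex.add_re]; ring] at h1

/-- Superadditivity of the minimal energy along tilings. -/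
theorem minEnergy_box_mul_le [NeZero n] (hc : IsBoundedBy c h) {k L N : ℕ} (hL : 0 < L)
    (hN : k * L ≤ N) :
    (k : ℝ) ^ d * minEnergy S h (box d 0 L) - c * ((N : ℝ) ^ d - ((k * L : ℕ) : ℝ) ^ d)
      ≤ minEnergy S h (box d 0 N) := by
  refine le_minEnergy fun ω hω => ?_
  have h1 : (k : ℝ) ^ d * minEnergy S h (box d 0 L) ≤ (ω (ham S h (box d 0 (k * L : ℕ)))).re := by
    rw [ham_re_eq_sum, sum_box_mul _ _ _ hL]
    refine le_trans ?_ (Finset.card_nsmul_le_sum _ _ _ fun j _ => minEnergy_le_translate hc hω _ _)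
    rw [nsmul_eq_mul, card_box (by positivity)]
    simp
  have h2 := hω.abs_ham_sub_le hc (box_subset (d := d) (le_refl 0) (Int.ofNat_le.2 hN))
  rw [card_box (by positivity), card_box (by positivity)] at h2
  simp only [Int.cast_natCast, Int.cast_zero, sub_zero] at h2
  linarith [(abs_le.1 h2).1]

open Filter Topology in
/-- The minimal energy per site of boxes converges, to its supremum, by superadditivity. -/
theorem exists_tendsto_minEnergy [NeZero n] (hc : IsBoundedBy c h) :
    ∃ l : ℝ, Tendsto (fun N : ℕ => minEnergy S h (box d 0 N) / (N : ℝ) ^ d) atTop (𝓝 l) := by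
  let q : ℕ → ℝ := fun N => minEnergy S h (box d 0 N) / (N : ℝ) ^ d
  have hc0 : 0 ≤ c := by
    obtain ⟨ω, hω⟩ := exists_isState (d := d) (n := n)
    exact (abs_nonneg _).trans (hω.abs_re_le (isBoundedBy_localHam hc 0)).1
  have hub : ∀ N, 0 < N → q N ≤ c := by
    intro N hN
    obtain ⟨ω, hω⟩ := exists_isState (d := d) (n := n)
    have h1 := (minEnergy_le hc hω (box d 0 N)).trans
      ((le_abs_self _).trans (hω.ham_re_le hc _).1)
    rw [card_box (by positivity)] at h1
    have : (0 : ℝ) < (N : ℝ) ^ d := by positivity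
    rw [div_le_iff₀ this]
    simpa using h1
  have hbdd : BddAbove (q '' Set.Ioi 0) := ⟨c, by rintro _ ⟨N, hN, rfl⟩; exact hub N hN⟩
  refine ⟨sSup (q '' Set.Ioi 0), tendsto_order.2 ⟨fun e he => ?_, fun e he => ?_⟩⟩
  · obtain ⟨_, ⟨L, hL, rfl⟩, hLe⟩ := exists_lt_of_lt_csSup
      (Set.Nonempty.image q ⟨1, Set.mem_Ioi.2 one_pos⟩) he
    have hL : 0 < L := hL
    -- the fraction of a side `N` that is covered by tiles of side `L`
    let u : ℕ → ℝ := fun N => 1 - ((N % L : ℕ) : ℝ) / N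
    have hu : Tendsto u atTop (𝓝 1) := by
      simpa using (tendsto_const_nhds (x := (1 : ℝ))).sub (tendsto_mod_div_atTop_nhds_zero_nat hL)
    have hlim : Tendsto (fun N => u N ^ d * q L - c * (1 - u N ^ d)) atTop (𝓝 (q L)) := by
      have := ((hu.pow d).mul_const (q L)).sub (((hu.pow d).const_sub 1).const_mul c)
      simpa using this
    filter_upwards [(tendsto_order.1 hlim).1 e hLe, eventually_gt_atTop 0] with N h1 hN
    refine h1.trans_le ?_
    have hN' : (0 : ℝ) < (N : ℝ) := by exact_mod_cast hN
    have huN : u N * N = ((N / L * L : ℕ) : ℝ) := by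
      have : ((N / L * L + N % L : ℕ) : ℝ) = N := by rw [Nat.div_add_mod']
      push_cast at this ⊢
      simp only [u]
      field_simp
      linarith
    have h2 := minEnergy_box_mul_le hc hL (Nat.div_mul_le_self N L)
    rw [le_div_iff₀ (by positivity)]
    refine le_trans (le_of_eq ?_) h2
    rw [← huN, mul_pow]
    have h3 : u N ^ d * q L * (N : ℝ) ^ d = ((N / L : ℕ) : ℝ) ^ d * minEnergy S h (box d 0 L) := by
      have : (L : ℝ) ^ d ≠ 0 := by positivity
      calc u N ^ d * q L * (N : ℝ) ^ d = (u N * N) ^ d * q L := by rw [mul_pow]; ring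
        _ = _ := by
          rw [huN]
          simp only [q]
          push_cast
          rw [mul_pow]
          field_simp
    rw [← h3]
    ring
  · filter_upwards [eventually_gt_atTop 0] with N hN
    exact (le_csSup hbdd ⟨N, hN, rfl⟩).trans_lt he

/-! ### Many translated perturbations -/

theorem exists_localOps_near (a : QL d n) {ε : ℝ} (hε : 0 < ε) :
    ∃ (R : Finset (Site d)) (b : QL d n), b ∈ localOps n R ∧ ‖a - b‖ < ε := by
  have ha : (a : Ambient d n →L[ℂ] Ambient d n) ∈ closure (localAlgebra d n : Set _) := a.2
  obtain ⟨b, hb, hab⟩ := Metric.mem_closure_iff.1 ha ε hε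
  obtain ⟨R, M, rfl⟩ := mem_localAlgebra.1 hb
  rw [dist_eq_norm] at hab
  exact ⟨R, emb R M, ⟨M, rfl⟩, hab⟩

/-- In a box of side `k L` there is room for `k ^ d` separated translates of given finite sets. -/
theorem exists_separated (Ω R E : Finset (Site d)) : ∃ L : ℕ, 0 < L ∧ ∀ k : ℕ,
    ∃ X : Finset (Site d), (X.card : ℝ) = (k : ℝ) ^ d ∧
      (∀ x ∈ X, ∀ x' ∈ X, x ≠ x' → Disjoint (translate x Ω) (translate x' R)) ∧
      ∀ x ∈ X, translate x E ⊆ box d 0 (k * L : ℕ) := by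
  obtain ⟨B, hB⟩ := exists_subset_box (Ω ∪ R ∪ E)
  have hBΩ : ∀ y ∈ Ω, ∀ i, -(B : ℤ) ≤ y i ∧ y i < B + 1 := fun y hy => mem_box.1 (hB (by simp [hy]))
  have hBR : ∀ y ∈ R, ∀ i, -(B : ℤ) ≤ y i ∧ y i < B + 1 := fun y hy => mem_box.1 (hB (by simp [hy]))
  have hBE : ∀ y ∈ E, ∀ i, -(B : ℤ) ≤ y i ∧ y i < B + 1 := fun y hy => mem_box.1 (hB (by simp [hy]))
  obtain ⟨L, hL⟩ : ∃ L : ℕ, L = 2 * B + 1 := ⟨_, rfl⟩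
  let p : Site d → Site d := fun j i => (L : ℤ) * j i + B
  have hp : Function.Injective p := by
    intro j j' hjj
    funext i
    have := congrFun hjj i
    simp only [p, add_left_inj] at this
    exact mul_left_cancel₀ (by omega) this
  have hlt : ∀ a b : ℤ, a < b → (L : ℤ) * a + L ≤ L * b := fun a b hab => by
    have : (L : ℤ) * (a + 1) ≤ L * b := mul_le_mul_of_nonneg_left hab (by omega)
    linarith
  refine ⟨L, by omega, fun k => ⟨(box d 0 k).map ⟨p, hp⟩, ?_, ?_, ?_⟩⟩
  · rw [Finset.card_map, card_box (by positivity)]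
    simp
  · intro x hx x' hx' hne
    obtain ⟨j, -, rfl⟩ := Finset.mem_map.1 hx
    obtain ⟨j', -, rfl⟩ := Finset.mem_map.1 hx'
    rw [Finset.disjoint_left]
    intro y hy hy'
    rw [mem_translate] at hy hy'
    suffices hjj : j = j' from hne (by rw [hjj])
    funext i
    have h1 := hBΩ _ hy i
    have h2 := hBR _ hy' i
    simp only [Function.Embedding.coeFn_mk, Pi.sub_apply, p] at h1 h2
    rcases lt_trichotomy (j i) (j' i) with h3 | h3 | h3
    · have := hlt _ _ h3
      omega
    · exact h3
    · have := hlt _ _ h3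
      omega
  · intro x hx y hy
    obtain ⟨j, hj, rfl⟩ := Finset.mem_map.1 hx
    rw [mem_translate] at hy
    refine mem_box.2 fun i => ?_
    have h1 := hBE _ hy i
    have h2 := mem_box.1 hj i
    simp only [Function.Embedding.coeFn_mk, Pi.sub_apply, p] at h1
    have h3 := hlt _ _ h2.2
    have h4 : 0 ≤ (L : ℤ) * j i := mul_nonneg (by omega) h2.1
    push_cast
    rw [mul_comm (k : ℤ)]
    constructor <;> omega

/-- If a local perturbation lowers the energy of an invariant state, then sufficiently separated
translates of it, applied one after the other, lower the energy by a fixed amount each. -/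
theorem exists_isState_lower {ω : QL d n →ₗ[ℂ] ℂ} (hω : IsState ω)
    (hinv : IsTranslationInvariant ω) {Ω : Finset (Site d)} {T : QL d n →ₗ[ℂ] QL d n}
    (hT : IsLocalPerturbation Ω T)
    (hlt : (ω (T (ham S h (enlarge S Ω)))).re < (ω (ham S h (enlarge S Ω))).re) :
    ∃ δ > 0, ∃ R : Finset (Site d), ∀ X : Finset (Site d),
      (∀ x ∈ X, ∀ x' ∈ X, x ≠ x' → Disjoint (translate x Ω) (translate x' R)) →
      ∃ ω' : QL d n →ₗ[ℂ] ℂ, IsState ω' ∧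
        (∀ Z, (∀ x ∈ X, Disjoint (translate x Ω) Z) → ∀ a ∈ localOps n Z, ω' a = ω a) ∧
        ∀ Λ, (∀ x ∈ X, translate x (enlarge S Ω) ⊆ Λ) →
          (ω' (ham S h Λ)).re ≤ (ω (ham S h Λ)).re - X.card * δ := by
  classical
  set D := T (ham S h (enlarge S Ω)) - ham S h (enlarge S Ω) with hD
  have hDω : (ω D).re < 0 := by rw [hD, map_sub, Complex.sub_re]; linarith
  set δ := -(ω D).re / 3 with hδ
  have hδ0 : 0 < δ := by linarith
  -- the energy change `D` need not be local, but it is up to `δ`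
  obtain ⟨R, b, hb, hDb⟩ := exists_localOps_near D hδ0
  refine ⟨δ, hδ0, R, fun X => ?_⟩
  induction X using Finset.induction_on with
  | empty => exact fun _ => ⟨ω, hω, fun _ _ _ _ => rfl, fun _ _ => by simp⟩
  | insert x X hx ih =>
    intro hsep
    obtain ⟨ω', hω', hloc, hen⟩ := ih fun y hy y' hy' =>
      hsep y (Finset.mem_insert_of_mem hy) y' (Finset.mem_insert_of_mem hy')
    have hTx := hT.translate x
    refine ⟨ω' ∘ₗ translateMap x T, hω'.comp_perturbation hTx, fun Z hZ a ha => ?_,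
      fun Λ hΛ => ?_⟩
    · rw [LinearMap.comp_apply, hTx.fix_local (hZ x (Finset.mem_insert_self _ _)) ha]
      exact hloc Z (fun y hy => hZ y (Finset.mem_insert_of_mem hy)) a ha
    · have h1 := hen Λ fun y hy => hΛ y (Finset.mem_insert_of_mem hy)
      have h2 : translateMap x T (ham S h Λ) = ham S h Λ + tau x D := by
        rw [← sub_eq_iff_eq_add', hTx.map_ham_sub
          (by rw [translate_enlarge]; exact hΛ x (Finset.mem_insert_self _ _)),
          translate_enlarge, ← tau_ham, translateMap_apply, tau_neg_tau, hD, map_sub]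
      have h3 : (ω' (tau x D)).re ≤ (ω' (tau x b)).re + δ := by
        have := (hω'.comp_starAlgHom (tau x)).re_le_norm (D - b)
        change (ω' (tau x (D - b))).re ≤ _ at this
        rw [map_sub, map_sub, Complex.sub_re] at this
        linarith
      have h4 : ω' (tau x b) = ω b := by
        rw [hloc _ (fun y hy => hsep y (Finset.mem_insert_of_mem hy) x (Finset.mem_insert_self _ _)
          (by rintro rfl; exact hx hy)) _ (tau_mem_localOps hb), hinv]
      have h5 : (ω b).re ≤ (ω D).re + δ := by
        have := hω.re_le_norm (b - D)
        rw [map_sub, Complex.sub_re, norm_sub_rev] at this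
        linarith
      rw [LinearMap.comp_apply, h2, map_add, Complex.add_re, Finset.card_insert_of_notMem hx]
      push_cast
      rw [h4] at h3
      linarith

theorem IsTranslationInvariant.localHam {ω : QL d n →ₗ[ℂ] ℂ} (hinv : IsTranslationInvariant ω)
    (x : Site d) : ω (localHam S h x) = ω (emb S h) := hinv x _

theorem IsTranslationInvariant.ham_re {ω : QL d n →ₗ[ℂ] ℂ} (hinv : IsTranslationInvariant ω)
    (Λ : Finset (Site d)) : (ω (ham S h Λ)).re = Λ.card * (ω (emb S h)).re := by
  rw [ham_re_eq_sum]
  simp [hinv.localHam]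

open Filter Topology in
/-- An invariant state whose energy per site is the minimal one is stable under all local
perturbations: otherwise a positive density of energy could be gained. -/
theorem mem_groundStates₂_of_energy_eq (hc : IsBoundedBy c h) {l : ℝ}
    (hl : Tendsto (fun N : ℕ => minEnergy S h (box d 0 N) / (N : ℝ) ^ d) atTop (𝓝 l))
    {ω : QL d n →ₗ[ℂ] ℂ} (hω : IsState ω) (hinv : IsTranslationInvariant ω)
    (he : (ω (emb S h)).re = l) : ω ∈ GroundStates₂ S h := by
  refine ⟨hω, fun Ω T hT => ?_⟩
  have him : (ω (T (ham S h (enlarge S Ω)))).im = 0 := by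
    rw [ham, map_sum, map_sum, Complex.im_sum]
    exact Finset.sum_eq_zero fun x _ =>
      (hω.abs_re_le ((isBoundedBy_localHam hc x).map hT.map_one hT.pos)).2
  refine Complex.le_def.2 ⟨?_, by rw [him, (hω.ham_re_le hc _).2]⟩
  by_contra! hlt
  obtain ⟨δ, hδ, R, hlow⟩ := exists_isState_lower hω hinv hT hlt
  obtain ⟨L, hL, hX⟩ := exists_separated Ω R (enlarge S Ω)
  have key : ∀ k : ℕ, 0 < k →
      minEnergy S h (box d 0 (k * L : ℕ)) / ((k * L : ℕ) : ℝ) ^ d ≤ l - δ / (L : ℝ) ^ d := by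
    intro k hk
    obtain ⟨X, hcard, hsep, hsub⟩ := hX k
    obtain ⟨ω', hω', -, hen⟩ := hlow X hsep
    have h1 := hen _ hsub
    rw [hinv.ham_re, card_box (by positivity), hcard, he] at h1
    have h2 := (minEnergy_le hc hω' _).trans h1
    have hkL : (0 : ℝ) < ((k * L : ℕ) : ℝ) ^ d := by positivity
    rw [div_le_iff₀ hkL]
    refine h2.trans_eq ?_
    have : (L : ℝ) ^ d ≠ 0 := by positivity
    push_cast
    rw [sub_zero, mul_pow]
    field_simp
  have hsub : Tendsto (fun k : ℕ => k * L) atTop atTop :=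
    tendsto_id.atTop_mul_const' hL
  have h1 := le_of_tendsto (hl.comp hsub) (by
    filter_upwards [eventually_gt_atTop 0] with k hk using key k hk)
  have h2 : 0 < δ / (L : ℝ) ^ d := by positivity
  linarith

end Box

section Torus

variable {d n : ℕ}

/-! ### The periodic lattice -/

/-- `extendOp p` as a unital `*`-homomorphism, for injective `p`. -/
noncomputable def extendHom {S T : Type} [Fintype S] [DecidableEq S] [Fintype T] [DecidableEq T]
    (p : S → T) (hp : Function.Injective p) : Op n S →⋆ₐ[ℂ] Op n T where
  toFun := extendOp p
  map_one' := extendOp_one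
  map_mul' := extendOp_mul hp
  map_zero' := by ext; simp [extendOp]
  map_add' M N := by
    ext σ τ
    simp only [extendOp, Matrix.of_apply, Matrix.add_apply]
    split_ifs <;> simp
  commutes' r := by
    have h : ∀ M : Op n S, extendOp p (r • M) = r • extendOp p M := fun M => by
      ext σ τ
      simp only [extendOp, Matrix.of_apply, Matrix.smul_apply]
      split_ifs <;> simp
    rw [Algebra.algebraMap_eq_smul_one, Algebra.algebraMap_eq_smul_one, h, extendOp_one]
  map_star' := extendOp_star p

/-- The sites of the periodic lattice, represented by the box `[0, L)^d`. -/
def torusEquiv (d L : ℕ) [NeZero L] : Torus d L ≃ box d 0 L where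
  toFun x := ⟨fun i => ((x i).val : ℤ), mem_box.2 fun i =>
    ⟨by positivity, by exact_mod_cast ZMod.val_lt (x i)⟩⟩
  invFun y := fun i => ((y : Site d) i : ZMod L)
  left_inv x := by
    funext i
    simp
  right_inv y := by
    refine Subtype.ext (funext fun i => ?_)
    have h := mem_box.1 y.2 i
    simp only [ZMod.val_intCast]
    exact Int.emod_eq_of_lt h.1 h.2

/-- The operators on the periodic lattice as operators on the box `[0, L)^d`. -/
noncomputable def torusHom (d n L : ℕ) [NeZero L] : Op n (Torus d L) →⋆ₐ[ℂ] QL d n :=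
  (emb (box d 0 L)).comp (extendHom (torusEquiv d L) (torusEquiv d L).injective)

theorem torusHom_apply {L : ℕ} [NeZero L] (M : Op n (Torus d L)) :
    torusHom d n L M = emb (box d 0 L) (extendOp (torusEquiv d L) M) := rfl

variable {S : Finset (Site d)} {h : Op n S} {c : ℝ} {B L : ℕ} [NeZero L]

/-- Away from the boundary of the box, the periodic interaction is the original one. -/
theorem torusHom_torusLocalHam (hS : S ⊆ box d (-B) (B + 1)) {y : box d 0 L}
    (hy : (y : Site d) ∈ box d B (L - B)) :
    torusHom d n L (torusLocalHam S h L ((torusEquiv d L).symm y)) = localHam S h y := by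
  rw [torusHom_apply, torusLocalHam, extendOp_comp _ (torusEquiv d L).injective, localHam, tau_emb]
  have hsub : translate y S ⊆ box d 0 L := by
    intro z hz
    rw [mem_translate] at hz
    have h1 := mem_box.1 (hS hz)
    have h2 := mem_box.1 hy
    refine mem_box.2 fun i => ?_
    have h1 := h1 i
    have h2 := h2 i
    simp only [Pi.sub_apply] at h1
    constructor <;> omega
  rw [← emb_extendOp hsub, extendOp_comp _ fun _ _ hxy => Subtype.ext (Subtype.mk.inj hxy)]
  congr 2
  funext s
  rw [Function.comp_apply, ← (torusEquiv d L).eq_symm_apply]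
  funext i
  simp [torusEquiv, translateEquiv, add_comm]

/-- For `L > 2 B` the sites of `S` are distinct modulo `L`, so `extendOp` is a homomorphism. -/
theorem isBoundedBy_torusLocalHam (hc : IsBoundedBy c h) (hS : S ⊆ box d (-B) (B + 1))
    (hL : 2 * B < L) (x : Torus d L) : IsBoundedBy c (torusLocalHam S h L x) := by
  have hp : Function.Injective fun (s : S) (i : Fin d) => x i + ((s : Site d) i : ZMod L) := by
    intro s s' hs
    refine Subtype.ext (funext fun i => ?_)
    have h1 := congrFun hs i
    simp only [add_right_inj] at h1
    have h2 := mem_box.1 (hS s.2) i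
    have h3 := mem_box.1 (hS s'.2) i
    rw [ZMod.intCast_eq_intCast_iff_dvd_sub] at h1
    have h4 := Int.eq_zero_of_abs_lt_dvd h1 (by rw [abs_lt]; constructor <;> omega)
    omega
  exact hc.map_starAlgHom (extendHom _ hp)

omit [NeZero L] in
theorem card_boundary (hL : 2 * B < L) :
    ((Finset.univ.filter fun y : box d 0 L => (y : Site d) ∉ box d B (L - B)).card : ℝ)
      = (L : ℝ) ^ d - ((L : ℝ) - 2 * B) ^ d := by
  have hsub : box d B (L - B) ⊆ box d 0 L := box_subset (by omega) (by omega)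
  have h1 : (box d 0 L \ box d B (L - B)).card
      = (Finset.univ.filter fun y : box d 0 L => (y : Site d) ∉ box d B (L - B)).card := by
    rw [← Finset.card_map (Function.Embedding.subtype _)]
    congr 1
    ext y
    simp [and_comm]
  rw [← h1, Finset.cast_card_sdiff hsub, card_box (by omega), card_box (by omega)]
  push_cast
  ring

/-- The energy with periodic boundary conditions differs from that of the box by a surface term. -/
theorem IsState.abs_torusHam_sub_le {ω : QL d n →ₗ[ℂ] ℂ} (hω : IsState ω) (hc : IsBoundedBy c h)
    (hS : S ⊆ box d (-B) (B + 1)) (hL : 2 * B < L) :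
    |(ω (torusHom d n L (torusHam S h L))).re - (ω (ham S h (box d 0 L))).re|
      ≤ 2 * c * ((L : ℝ) ^ d - ((L : ℝ) - 2 * B) ^ d) := by
  classical
  let f : box d 0 L → ℝ := fun y =>
    (ω (torusHom d n L (torusLocalHam S h L ((torusEquiv d L).symm y)))).re
      - (ω (localHam S h y)).re
  have hsum : (ω (torusHom d n L (torusHam S h L))).re - (ω (ham S h (box d 0 L))).re
      = ∑ y, f y := by
    rw [ham_re_eq_sum, ← Finset.sum_coe_sort, Finset.sum_sub_distrib, torusHam, map_sum, map_sum,
      Complex.re_sum, ← (torusEquiv d L).symm.sum_comp]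
  have hin : ∀ y : box d 0 L, (y : Site d) ∈ box d B (L - B) → f y = 0 := fun y hy => by
    simp only [f, torusHom_torusLocalHam hS hy, sub_self]
  have hout : ∀ y, |f y| ≤ 2 * c := fun y => by
    have h1 := (hω.abs_re_le
      ((isBoundedBy_torusLocalHam hc hS hL ((torusEquiv d L).symm y)).map_starAlgHom
        (torusHom d n L))).1
    have h2 := (hω.abs_re_le (isBoundedBy_localHam hc (y : Site d))).1
    exact (abs_sub _ _).trans (by linarith)
  rw [hsum, ← Finset.sum_filter_add_sum_filter_not Finset.univ
    (fun y : box d 0 L => (y : Site d) ∈ box d B (L - B)),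
    Finset.sum_eq_zero fun y hy => hin y (Finset.mem_filter.1 hy).2, zero_add]
  refine (Finset.abs_sum_le_sum_abs _ _).trans ?_
  refine (Finset.sum_le_card_nsmul _ _ (2 * c) fun y _ => hout y).trans_eq ?_
  rw [nsmul_eq_mul, card_boundary hL, mul_comm]

theorem isHermitian_torusHam (hh : h.IsHermitian) : (torusHam S h L).IsHermitian := by
  refine isSelfAdjoint_sum _ fun x _ => ?_
  rw [isSelfAdjoint_iff, torusLocalHam, ← extendOp_star, show star h = h from hh]

/-- The operators `|v⟩⟨t|`, `t` running over a basis, implement the replacement of every state by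
the vector state of `v`. -/
theorem sum_star_vecMulVec_mul {m : Type} [Fintype m] [DecidableEq m] (v : m → ℂ)
    (M : Matrix m m ℂ) :
    ∑ t, star (Matrix.vecMulVec v (Pi.single t 1)) * M * Matrix.vecMulVec v (Pi.single t 1)
      = dotProduct (star v) (Matrix.mulVec M v) • (1 : Matrix m m ℂ) := by
  have h1 : ∀ t, star (Matrix.vecMulVec v (Pi.single t 1)) * M * Matrix.vecMulVec v (Pi.single t 1)
      = dotProduct (star v) (Matrix.mulVec M v) • Matrix.single t t (1 : ℂ) := by
    intro t
    rw [mul_assoc, Matrix.mul_vecMulVec, Matrix.star_eq_conjTranspose,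
      Matrix.conjTranspose_vecMulVec, Matrix.vecMulVec_mul_vecMulVec]
    ext i j
    simp [Matrix.vecMulVec_apply, Matrix.single_apply, Pi.single_apply, @eq_comm _ i t,
      @eq_comm _ j t]
    by_cases hi : t = i <;> by_cases hj : t = j <;> simp [hi, hj]
  simp only [h1]
  rw [← Finset.smul_sum, ← Matrix.sum_single_one]

theorem IsState.le_re {m : Type} [Fintype m] [DecidableEq m] {M : Matrix m m ℂ}
    {ρ : Matrix m m ℂ →ₗ[ℂ] ℂ} (hρ : IsState ρ) {l : ℝ} (hl : (M - (l : ℂ) • 1).PosSemidef) :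
    l ≤ (ρ M).re := by
  obtain ⟨b, hb⟩ := isPos_of_posSemidef hl
  have h1 := hρ.nonneg b
  rw [← hb, map_sub, map_smul, hρ.map_one, smul_eq_mul, mul_one] at h1
  have h2 := (Complex.le_def.1 h1).1
  simp only [Complex.zero_re, Complex.sub_re, Complex.ofReal_re] at h2
  linarith

theorem le_torusEnergy [NeZero n] {l : ℝ}
    (hl : (torusHam S h L - (l : ℂ) • 1).PosSemidef) : l / (L : ℝ) ^ d ≤ torusEnergy S h L := by
  have hLd : (0 : ℝ) < (L : ℝ) ^ d := by
    have : (0 : ℝ) < L := by exact_mod_cast Nat.pos_of_neZero L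
    positivity
  obtain ⟨ω, hω⟩ := exists_isState (d := d) (n := n)
  refine le_csInf ⟨_, _, hω.comp_starAlgHom (torusHom d n L), rfl⟩ ?_
  rintro _ ⟨ρ, hρ, rfl⟩
  exact div_le_div_of_nonneg_right (hρ.le_re hl) hLd.le

/-- The box `[0, L)^d` turns a state on the infinite lattice into one on the periodic lattice. -/
theorem torusEnergy_le [NeZero n] (hh : h.IsHermitian) {ω : QL d n →ₗ[ℂ] ℂ} (hω : IsState ω) :
    (L : ℝ) ^ d * torusEnergy S h L ≤ (ω (torusHom d n L (torusHam S h L))).re := by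
  have hLd : (0 : ℝ) < (L : ℝ) ^ d := by
    have : (0 : ℝ) < L := by exact_mod_cast Nat.pos_of_neZero L
    positivity
  obtain ⟨l, v, -, -, hl⟩ := exists_min_eigenvector (isHermitian_torusHam (L := L) hh)
  rw [← le_div_iff₀' hLd]
  refine csInf_le ⟨l / (L : ℝ) ^ d, ?_⟩ ⟨_, hω.comp_starAlgHom (torusHom d n L), rfl⟩
  rintro _ ⟨ρ, hρ, rfl⟩
  exact div_le_div_of_nonneg_right (hρ.le_re hl) hLd.le

/-- There is a local perturbation in Kraus form on the box `[0, L)^d` which turns every state into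
one that looks like a periodic ground state in the box. -/
theorem exists_kraus_torusEnergy [NeZero n] (hh : h.IsHermitian) :
    ∃ K : Conf n (Torus d L) → QL d n, (∀ t, K t ∈ localOps n (box d 0 L)) ∧
      ∑ t, star (K t) * K t = 1 ∧ ∀ ω : QL d n →ₗ[ℂ] ℂ, IsState ω →
        (ω (krausMap K (torusHom d n L (torusHam S h L)))).re
          ≤ (L : ℝ) ^ d * torusEnergy S h L := by
  have hLd : (0 : ℝ) < (L : ℝ) ^ d := by
    have : (0 : ℝ) < L := by exact_mod_cast Nat.pos_of_neZero L
    positivity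
  obtain ⟨l, v, hv, hvl, hl⟩ := exists_min_eigenvector (isHermitian_torusHam (L := L) hh)
  -- `h0 M` says that the Kraus map sends `M` to the scalar `⟨v, M v⟩`
  have h0 := fun M => congrArg (torusHom d n L) (sum_star_vecMulVec_mul v M)
  simp only [map_sum, map_mul, map_star, map_smul, map_one] at h0
  refine ⟨fun t => torusHom d n L (Matrix.vecMulVec v (Pi.single t 1)), fun t => ⟨_, rfl⟩, ?_,
    fun ω hω => ?_⟩
  · simpa [hv] using h0 1
  · rw [krausMap_apply, h0, hvl, map_smul, hω.map_one, smul_eq_mul, mul_one, Complex.ofReal_re,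
      ← div_le_iff₀' hLd]
    exact le_torusEnergy hl

/-- Up to a surface term, the periodic ground state energy is the minimal energy of the box. -/
theorem abs_torusEnergy_sub_minEnergy_le [NeZero n] (hh : h.IsHermitian) (hc : IsBoundedBy c h)
    (hS : S ⊆ box d (-B) (B + 1)) (hL : 2 * B < L) :
    |(L : ℝ) ^ d * torusEnergy S h L - minEnergy S h (box d 0 L)|
      ≤ 2 * c * ((L : ℝ) ^ d - ((L : ℝ) - 2 * B) ^ d) := by
  rw [abs_le]
  constructor
  · obtain ⟨K, hK, h1, hE⟩ := exists_kraus_torusEnergy (L := L) hh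
    obtain ⟨ω, hω⟩ := exists_isState (d := d) (n := n)
    have hω' := hω.comp_perturbation (isLocalPerturbation_krausMap hK h1)
    have h2 := (abs_le.1 (hω'.abs_torusHam_sub_le hc hS hL)).1
    have h3 := minEnergy_le hc hω' (box d 0 L)
    have h4 := hE ω hω
    simp only [LinearMap.comp_apply] at h2 h3
    linarith
  · have h1 : (L : ℝ) ^ d * torusEnergy S h L
        - 2 * c * ((L : ℝ) ^ d - ((L : ℝ) - 2 * B) ^ d) ≤ minEnergy S h (box d 0 L) := by
      refine le_minEnergy fun ω hω => ?_
      have h2 := (abs_le.1 (hω.abs_torusHam_sub_le hc hS hL)).2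
      have h3 := torusEnergy_le (L := L) hh hω
      linarith
    linarith

omit [NeZero L] in
theorem enlarge_box_subset (hS : S ⊆ box d (-B) (B + 1)) :
    enlarge S (box d 0 L) ⊆ box d (-B) (L + B) := by
  intro x hx
  obtain ⟨⟨y, s⟩, hp, rfl⟩ := Finset.mem_image.1 hx
  obtain ⟨hy, hs⟩ := Finset.mem_product.1 hp
  have h1 := mem_box.1 hy
  have h2 := mem_box.1 (hS hs)
  refine mem_box.2 fun i => ?_
  have h1 := h1 i
  have h2 := h2 i
  simp only [Pi.sub_apply] at h1 h2 ⊢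
  constructor <;> omega

/-- A stable invariant state has at most the periodic ground state energy, up to a surface term. -/
theorem IsKrausStable.energy_le [NeZero n] {ω : QL d n →ₗ[ℂ] ℂ} (hω : IsState ω)
    (hinv : IsTranslationInvariant ω) (hs : IsKrausStable S h ω) (hh : h.IsHermitian)
    (hc : IsBoundedBy c h) (hS : S ⊆ box d (-B) (B + 1)) (hL : 2 * B < L) :
    ((L : ℝ) + 2 * B) ^ d * (ω (emb S h)).re ≤ (L : ℝ) ^ d * torusEnergy S h L
      + 2 * c * ((L : ℝ) ^ d - ((L : ℝ) - 2 * B) ^ d)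
      + c * (((L : ℝ) + 2 * B) ^ d - (L : ℝ) ^ d) := by
  have hsub : box d 0 L ⊆ box d (-B) (L + B) := box_subset (by omega) (by omega)
  have hcard : ((box d (-B) (L + B)).card : ℝ) = ((L : ℝ) + 2 * B) ^ d := by
    rw [card_box (by omega)]
    push_cast
    ring
  have hcard' : ((box d 0 L).card : ℝ) = (L : ℝ) ^ d := by
    rw [card_box (by omega)]
    push_cast
    ring
  obtain ⟨K, hK, h1, hE⟩ := exists_kraus_torusEnergy (L := L) hh
  have hω' := hω.comp_perturbation (isLocalPerturbation_krausMap hK h1)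
  have h2 := hs.le_of_subset (enlarge_box_subset hS) hK h1
  have h3 := (abs_le.1 (hω'.abs_torusHam_sub_le hc hS hL)).1
  have h4 := (abs_le.1 (hω'.abs_ham_sub_le hc hsub)).2
  have h5 := hE ω hω
  rw [hinv.ham_re, hcard] at h2
  rw [hcard, hcard'] at h4
  simp only [LinearMap.comp_apply] at h3 h4
  linarith

open Filter Topology in
theorem tendsto_side_ratio (b : ℝ) :
    Tendsto (fun N : ℕ => (((N + 1 : ℕ) : ℝ) + b) ^ d / ((N + 1 : ℕ) : ℝ) ^ d) atTop (𝓝 1) := by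
  have h1 : Tendsto (fun N : ℕ => b / ((N + 1 : ℕ) : ℝ)) atTop (𝓝 0) :=
    (tendsto_const_div_atTop_nhds_zero_nat b).comp (tendsto_add_atTop_nat 1)
  have h2 := (h1.const_add 1).pow d
  simp only [add_zero, one_pow] at h2
  refine h2.congr fun N => ?_
  have : ((N + 1 : ℕ) : ℝ) ≠ 0 := by positivity
  rw [← div_pow, add_div, div_self this]

end Torus

section Limit

variable {d n : ℕ} {S : Finset (Site d)} {h : Op n S} {c : ℝ}

open Filter Topology

/-! ### The energy density -/

theorem tendsto_torusEnergy [NeZero n] (hh : h.IsHermitian) (hc : IsBoundedBy c h) {l : ℝ}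
    (hl : Tendsto (fun N : ℕ => minEnergy S h (box d 0 N) / (N : ℝ) ^ d) atTop (𝓝 l)) :
    Tendsto (fun N : ℕ => torusEnergy S h (N + 1)) atTop (𝓝 l) := by
  obtain ⟨B, hS⟩ := exists_subset_box S
  have hl' := hl.comp (tendsto_add_atTop_nat 1)
  have hr : Tendsto (fun N : ℕ => 2 * c * (1 - (((N + 1 : ℕ) : ℝ) + -(2 * B)) ^ d
      / ((N + 1 : ℕ) : ℝ) ^ d)) atTop (𝓝 0) := by
    simpa using ((tendsto_side_ratio (d := d) (-(2 * B : ℝ))).const_sub 1).const_mul (2 * c)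
  have hdiff : Tendsto (fun N : ℕ => torusEnergy S h (N + 1)
      - minEnergy S h (box d 0 (N + 1 : ℕ)) / ((N + 1 : ℕ) : ℝ) ^ d) atTop (𝓝 0) := by
    refine squeeze_zero_norm' ?_ hr
    filter_upwards [eventually_ge_atTop (2 * B)] with N hN
    have h1 := abs_torusEnergy_sub_minEnergy_le (L := N + 1) hh hc hS (by omega)
    have hLd : (0 : ℝ) < ((N + 1 : ℕ) : ℝ) ^ d := by positivity
    rw [Real.norm_eq_abs, ← mul_le_mul_iff_right₀ hLd]
    refine le_trans (le_of_eq ?_) (h1.trans_eq ?_)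
    · rw [← abs_of_pos hLd, ← abs_mul, abs_of_pos hLd, mul_sub, mul_div_cancel₀ _ hLd.ne']
    · rw [← sub_eq_add_neg]
      field_simp
  simpa using hdiff.add hl'

/-- A stable invariant state has the minimal energy per site. -/
theorem IsKrausStable.energy_eq [NeZero n] {ω : QL d n →ₗ[ℂ] ℂ} (hω : IsState ω)
    (hinv : IsTranslationInvariant ω) (hs : IsKrausStable S h ω) (hh : h.IsHermitian)
    (hc : IsBoundedBy c h) {l : ℝ}
    (hl : Tendsto (fun N : ℕ => minEnergy S h (box d 0 N) / (N : ℝ) ^ d) atTop (𝓝 l)) :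
    (ω (emb S h)).re = l := by
  obtain ⟨B, hS⟩ := exists_subset_box S
  apply le_antisymm
  · have h1 : Tendsto (fun N : ℕ =>
        (((N + 1 : ℕ) : ℝ) + 2 * B) ^ d / ((N + 1 : ℕ) : ℝ) ^ d * (ω (emb S h)).re) atTop
        (𝓝 (ω (emb S h)).re) := by
      simpa using (tendsto_side_ratio (d := d) (2 * B : ℝ)).mul_const _
    have h2 : Tendsto (fun N : ℕ => torusEnergy S h (N + 1)
        + 2 * c * (1 - (((N + 1 : ℕ) : ℝ) + -(2 * B)) ^ d / ((N + 1 : ℕ) : ℝ) ^ d)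
        + c * ((((N + 1 : ℕ) : ℝ) + 2 * B) ^ d / ((N + 1 : ℕ) : ℝ) ^ d - 1)) atTop (𝓝 l) := by
      simpa using ((tendsto_torusEnergy hh hc hl).add
        (((tendsto_side_ratio (d := d) (-(2 * B : ℝ))).const_sub 1).const_mul (2 * c))).add
        (((tendsto_side_ratio (d := d) (2 * B : ℝ)).sub_const 1).const_mul c)
    refine le_of_tendsto_of_tendsto h1 h2 ?_
    filter_upwards [eventually_ge_atTop (2 * B)] with N hN
    have h3 := hs.energy_le (L := N + 1) hω hinv hh hc hS (by omega)
    have hLd : (0 : ℝ) < ((N + 1 : ℕ) : ℝ) ^ d := by positivity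
    rw [← mul_le_mul_iff_right₀ hLd]
    refine le_trans (le_of_eq ?_) (h3.trans_eq ?_)
    · field_simp
    · rw [← sub_eq_add_neg]
      field_simp
  · refine le_of_tendsto hl ?_
    filter_upwards [eventually_gt_atTop 0] with N hN
    have h1 := minEnergy_le hc hω (box d 0 N)
    rw [hinv.ham_re, card_box (by positivity)] at h1
    rw [div_le_iff₀ (by positivity), mul_comm]
    simpa using h1

end Limit

end SpinLattice

theorem mainTheorem10 (d n : ℕ) [NeZero n] (S : Finset (SpinLattice.Site d))
    (h : SpinLattice.Op n S) (hh : h.IsHermitian) :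
    Filter.Tendsto (fun L : ℕ => SpinLattice.torusEnergy S h (L + 1)) Filter.atTop
        (nhds (SpinLattice.energyDensity S h)) ∧
      SpinLattice.invariantPart (SpinLattice.GroundStates₁ S h)
        = SpinLattice.invariantPart (SpinLattice.GroundStates₂ S h) ∧
      SpinLattice.invariantPart (SpinLattice.GroundStates₂ S h)
        = SpinLattice.invariantPart (SpinLattice.GroundStates₃ S h) := by
  obtain ⟨c, hc⟩ := SpinLattice.exists_isBoundedBy hh
  obtain ⟨l, hl⟩ := SpinLattice.exists_tendsto_minEnergy hc
  have hlim := SpinLattice.tendsto_torusEnergy hh hc hl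
  have hE : SpinLattice.energyDensity S h = l := hlim.limUnder_eq
  have h13 : ∀ ω, SpinLattice.IsState ω → SpinLattice.IsTranslationInvariant ω →
      SpinLattice.IsKrausStable S h ω → ω ∈ SpinLattice.GroundStates₃ S h := by
    intro ω hω hinv hs
    refine ⟨hω, fun x => Complex.ext ?_ ?_⟩
    · rw [hinv.localHam, hs.energy_eq hω hinv hh hc hl, hE, Complex.ofReal_re]
    · rw [(hω.abs_re_le (SpinLattice.isBoundedBy_localHam hc x)).2, Complex.ofReal_im]
  have h32 : ∀ ω ∈ SpinLattice.GroundStates₃ S h, SpinLattice.IsTranslationInvariant ω →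
      ω ∈ SpinLattice.GroundStates₂ S h := by
    intro ω hω hinv
    refine SpinLattice.mem_groundStates₂_of_energy_eq hc hl hω.1 hinv ?_
    rw [← hinv.localHam 0, hω.2 0, hE, Complex.ofReal_re]
  rw [hE]
  refine ⟨hlim, Set.ext fun ω => ⟨fun ⟨hω, hinv⟩ => ⟨?_, hinv⟩, fun ⟨hω, hinv⟩ => ⟨?_, hinv⟩⟩,
    Set.ext fun ω => ⟨fun ⟨hω, hinv⟩ => ⟨?_, hinv⟩, fun ⟨hω, hinv⟩ => ⟨h32 ω hω hinv, hinv⟩⟩⟩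
  · exact h32 ω (h13 ω hω.1 hinv (SpinLattice.isKrausStable_of_mem_groundStates₁ hω)) hinv
  · exact (SpinLattice.isKrausStable_of_mem_groundStates₂ hω).mem_groundStates₁ hω.1 hh
  · exact h13 ω hω.1 hinv (SpinLattice.isKrausStable_of_mem_groundStates₂ hω)
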